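/- **Conventions.** All spaces are diffeological spaces; subsets, products, disjoint unions and quotients carry the standard diffeologies; the pushforward of a diffeology by a map is the finest diffeology on the target for which the map is smooth. A *diffeological vector pseudo-bundle* $\pi:V\to X$ is a smooth map whose fibres $V_x$ are real vector spaces, such that the fibrewise addition $V\times_XV\to V$, the scalar multiplication $\mathbb R\times V\to V$ and the zero section are smooth. A *pseudo-metric* on a pseudo-bundle $V$ with finite-dimensional fibres is a family $g(x)$ of symmetric positive semidefinite bilinear forms on the fibres $V_x$, smooth in the sense that for all plots $v,w$ of $V$ over the same map $p$ to $X$ the function $u\mapsto g(p(u))(v(u),w(u))$ is smooth, and such that for every $x$ the kernel of $g(x)$ has dimension $\dim V_x-\dim V_x^*$, where $V_x^*$ is the space of smooth linear functionals on $V_x$. The Clifford algebra $C\ell(V_x,g(x))$ has the relations $v\cdot w+w\cdot v=-2g(x)(v,w)$; the pseudo-bundle $C\ell(V,g)$ of these algebras has the finest diffeology for which it is a pseudo-bundle of unital algebras (smooth fibrewise product and unit section) and $V\to C\ell(V,g)$ is smooth. A *smooth Clifford action* of $C\ell(V,g)$ on a pseudo-bundle $E\to X$ is a family of unital algebra homomorphisms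 $C\ell(V_x,g(x))\to\mathrm{End}(E_x)$ for which the evaluation $C\ell(V,g)\times_XE\to E$, $(a,e)\mapsto c(a)(e)$, is smooth; $E$ is then a pseudo-bundle of Clifford modules. A *differential 1-form* $\omega\in\Omega^1(X)$ assigns to every plot $p:U\to X$ a smooth 1-form $\omega(p)$ on $U$, with $\omega(p\circ h)=h^*(\omega(p))$ for all smooth $h$; $\Omega^1(X)$ has the functional diffeology. The form $\omega$ vanishes at $x$ if $\omega(p)(0)=0$ for every plot $p$ with $p(0)=x$; $\Omega^1_x(X)$ is the space of these forms, $\Lambda^1_x(X)=\Omega^1(X)/\Omega^1_x(X)$, and $\Lambda^1(X)=\bigsqcup_x\Lambda^1_x(X)$ has the quotient diffeology of $X\times\Omega^1(X)$. A smooth Clifford action $c$ of $C\ell(\Lambda^1(X),g^\Lambda)$ on $E$ is *unitary* with respect to a pseudo-metric $g$ on $E$ and to $g^\Lambda$ if $g(x)(c(\alpha)e_1,c(\alpha)e_2)=g(x)(e_1,e_2)$ for all $x\in X$, all $\alpha\in\Lambda^1_x(X)$ with $g^\Lambda(x)(\alpha,\alpha)=1$ and all $e_1,e_2\in E_x$.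 **Setting.** Let $X_1,X_2$ be diffeological spaces, $Y\subseteq X_1$, and let $f:Y\to X_2$ be a diffeomorphism with its image. Let $X_1\cup_fX_2$ be the quotient of $X_1\sqcup X_2$ by the equivalence relation generated by $y\sim f(y)$, $y\in Y$, and let $\tilde i_1:X_1\to X_1\cup_fX_2$ and $i_2:X_2\to X_1\cup_fX_2$ be the natural maps, so that $X_1\cup_fX_2$ is the disjoint union of $\tilde i_1(X_1\setminus Y)$ and $i_2(X_2)$. Assume $\mathcal D_1^\Omega=\mathcal D_2^\Omega$, where $\mathcal D_1^\Omega$ is the pushforward of the diffeology of $\Omega^1(X_1)$ to $\Omega^1(Y)$ by the restriction $i^*$ along $i:Y\hookrightarrow X_1$, and $\mathcal D_2^\Omega$ is the pushforward of the diffeology of $\Omega^1(X_2)$ by $f^*$. The pullbacks of forms along $\tilde i_1$ and $i_2$ induce linear maps $\tilde\rho_1^\Lambda:\Lambda^1_{\tilde i_1(x)}(X_1\cup_fX_2)\to\Lambda^1_x(X_1)$, $x\in X_1$, and $\tilde\rho_2^\Lambda:\Lambda^1_{i_2(x)}(X_1\cup_fX_2)\to\Lambda^1_x(X_2)$, $x\in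 X_2$. For $y\in Y$, elements $\alpha_1\in\Lambda^1_y(X_1)$ and $\alpha_2\in\Lambda^1_{f(y)}(X_2)$ are *compatible* if they are the values at $y$ and $f(y)$ of forms $\omega_1\in\Omega^1(X_1)$, $\omega_2\in\Omega^1(X_2)$ with $\omega_1(p)=\omega_2(f\circ p)$ for every plot $p$ of $Y$. Let $g_1^\Lambda,g_2^\Lambda$ be pseudo-metrics on $\Lambda^1(X_1),\Lambda^1(X_2)$ (in particular, these have finite-dimensional fibres) which are compatible: $g_1^\Lambda(y)(\alpha_1,\beta_1)=g_2^\Lambda(f(y))(\alpha_2,\beta_2)$ for all $y\in Y$ and all compatible pairs $(\alpha_1,\alpha_2)$, $(\beta_1,\beta_2)$ over $y$. Define $g^\Lambda$ on $\Lambda^1(X_1\cup_fX_2)$ by $$g^\Lambda(z)(\alpha,\beta)=\begin{cases}g_1^\Lambda(x)(\tilde\rho_1^\Lambda\alpha,\tilde\rho_1^\Lambda\beta)&z=\tilde i_1(x),\ x\in X_1\setminus Y,\\ \tfrac12\big(g_1^\Lambda(y)(\tilde\rho_1^\Lambda\alpha,\tilde\rho_1^\Lambda\beta)+g_2^\Lambda(f(y))(\tilde\rho_2^\Lambda\alpha,\tilde\rho_2^\Lambda\beta)\big)&z=i_2(f(y)),\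 y\in Y,\\ g_2^\Lambda(x)(\tilde\rho_2^\Lambda\alpha,\tilde\rho_2^\Lambda\beta)&z=i_2(x),\ x\in X_2\setminus f(Y).\end{cases}$$ For $i=1,2$ let $\chi_i:E_i\to X_i$ be a pseudo-bundle of Clifford modules over $C\ell(\Lambda^1(X_i),g_i^\Lambda)$ with smooth Clifford action $c_i$. Let $\tilde f':\chi_1^{-1}(Y)\to E_2$ be a fibrewise linear map covering $f$ which is a diffeomorphism with its image, and let $E_1\cup_{\tilde f'}E_2\to X_1\cup_fX_2$ be the result of gluing; its fibre is $(E_1)_x$ over $\tilde i_1(x)$, $x\in X_1\setminus Y$, and $(E_2)_x$ over $i_2(x)$, $x\in X_2$. Assume that $c_1$ and $c_2$ are compatible: $c_2(\tilde\rho_2^\Lambda\alpha)(\tilde f'(e))=\tilde f'(c_1(\tilde\rho_1^\Lambda\alpha)(e))$ for all $y\in Y$, $\alpha\in\Lambda^1_{i_2(f(y))}(X_1\cup_fX_2)$ and $e\in(E_1)_y$. The induced action $\tilde c$ is given on $\alpha\in\Lambda^1_z(X_1\cup_fX_2)$ by $c_1(\tilde\rho_1^\Lambda\alpha)$ if $z\in\tilde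 i_1(X_1\setminus Y)$ and by $c_2(\tilde\rho_2^\Lambda\alpha)$ if $z\in i_2(X_2)$, and is extended to $C\ell(\Lambda^1(X_1\cup_fX_2),g^\Lambda)$ by the universal property. Let $g_1,g_2$ be pseudo-metrics on $E_1,E_2$ which are compatible: $g_1(y)(v,w)=g_2(f(y))(\tilde f'(v),\tilde f'(w))$ for all $y\in Y$ and $v,w\in(E_1)_y$. Let $\tilde g$ be the family of forms on the fibres of $E_1\cup_{\tilde f'}E_2$ equal to $g_1(x)$ over $\tilde i_1(x)$, $x\in X_1\setminus Y$, and to $g_2(x)$ over $i_2(x)$, $x\in X_2$. **Proposition.** In this setting, $E_1\cup_{\tilde f'}E_2$ is a diffeological vector pseudo-bundle, $g^\Lambda$ is a pseudo-metric on $\Lambda^1(X_1\cup_fX_2)$, $\tilde g$ is a pseudo-metric on $E_1\cup_{\tilde f'}E_2$, and $\tilde c$ is a well-defined smooth Clifford action of $C\ell(\Lambda^1(X_1\cup_fX_2),g^\Lambda)$ on $E_1\cup_{\tilde f'}E_2$. If the actions $c_1$ and $c_2$ are unitary (with respect to $g_1,g_1^\Lambda$ and to $g_2,g_2^\Lambda$),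 then $\tilde c$ is unitary with respect to $\tilde g$ and $g^\Lambda$. -/

import Mathlib

open Diffeology
open scoped ContDiff

noncomputable section

namespace DiffGluing

/-- The Euclidean spaces on which plots are defined. -/
abbrev Euc (n : ℕ) : Type := EuclideanSpace ℝ (Fin n)

/-! ### Standard constructions of diffeologies -/

section Diffeologies

variable {A B : Type*}

/-- Pullback diffeology: the coarsest diffeology on `A` for which `h : A → B` is smooth. -/
@[reducible]
def induced (h : A → B) (D : DiffeologicalSpace B) : DiffeologicalSpace A where
  plots n := {p | IsPlot (h ∘ p)}
  constant_plots x := D.constant_plots (h x)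
  plot_reparam hp hf := D.plot_reparam hp hf
  locality hp := D.locality fun x => by
    obtain ⟨u, hu, hxu, H⟩ := hp x
    exact ⟨u, hu, hxu, fun hfu hf => H hfu hf⟩

/-- Pushforward diffeology: the finest diffeology on `B` for which `h : A → B` is smooth. For a
surjective `h` this is the quotient diffeology. -/
@[reducible]
def coinduced (h : A → B) (D : DiffeologicalSpace A) : DiffeologicalSpace B :=
  DiffeologicalSpace.generateFrom {q | ∃ p : Euc q.1 → A, IsPlot p ∧ q.2 = h ∘ p}

theorem isPlot_coinduced (h : A → B) (D : DiffeologicalSpace A) {n : ℕ} {p : Euc n → A}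
    (hp : IsPlot p) : @IsPlot B (coinduced h D) n (h ∘ p) :=
  DiffeologicalSpace.isPlot_generatedFrom_of_mem ⟨p, hp, rfl⟩

/-- Subset diffeology. -/
instance [DiffeologicalSpace A] (s : Set A) : DiffeologicalSpace s :=
  induced Subtype.val inferInstance

/-- Subset diffeology, for subsets given by a predicate. -/
instance [DiffeologicalSpace A] (P : A → Prop) : DiffeologicalSpace {a // P a} :=
  induced Subtype.val inferInstance

/-- Product diffeology. -/
instance [DiffeologicalSpace A] [DiffeologicalSpace B] : DiffeologicalSpace (A × B) :=
  induced Prod.fst inferInstance ⊓ induced Prod.snd inferInstance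

/-- Disjoint union diffeology: the finest one for which both injections are smooth. -/
instance [DiffeologicalSpace A] [DiffeologicalSpace B] : DiffeologicalSpace (A ⊕ B) :=
  coinduced Sum.inl inferInstance ⊔ coinduced Sum.inr inferInstance

theorem dSmooth_coinduced [D : DiffeologicalSpace A] (h : A → B) :
    @DSmooth A B D (coinduced h D) h :=
  fun _ _ hp => isPlot_coinduced h D hp

theorem dSmooth_inl [DiffeologicalSpace A] [DiffeologicalSpace B] :
    DSmooth (Sum.inl : A → A ⊕ B) := fun _ _ hp =>
  DiffeologicalSpace.le_iff'.1 (le_sup_left (a := coinduced (Sum.inl : A → A ⊕ B) inferInstance)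
    (b := coinduced Sum.inr inferInstance)) _ _ (isPlot_coinduced _ _ hp)

theorem dSmooth_inr [DiffeologicalSpace A] [DiffeologicalSpace B] :
    DSmooth (Sum.inr : B → A ⊕ B) := fun _ _ hp =>
  DiffeologicalSpace.le_iff'.1 (le_sup_right (a := coinduced (Sum.inl : A → A ⊕ B) inferInstance)
    (b := coinduced Sum.inr inferInstance)) _ _ (isPlot_coinduced _ _ hp)

/-- `h` is a diffeomorphism of `A` with its image `h(A) ⊆ B`, the latter endowed with the subset
diffeology: `h` is injective, and `p` is a plot of `A` exactly when `h ∘ p` is a plot of `B`. -/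
structure IsDiffeoOntoImage [DiffeologicalSpace A] [DiffeologicalSpace B] (h : A → B) : Prop where
  injective : Function.Injective h
  isPlot_iff : ∀ (n : ℕ) (p : Euc n → A), IsPlot p ↔ IsPlot (h ∘ p)

theorem IsDiffeoOntoImage.dSmooth [DiffeologicalSpace A] [DiffeologicalSpace B] {h : A → B}
    (H : IsDiffeoOntoImage h) : DSmooth h :=
  fun n p hp => (H.isPlot_iff n p).1 hp

end Diffeologies

/-! ### Differential 1-forms and the pseudo-bundle `Λ¹(X)` -/

section Forms

/-- `Ω¹(X)`: a differential 1-form `η` assigns to every plot `p` a smooth 1-form `η(p)` on the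
domain of `p`, in such a way that `η(p ∘ h) = h^*(η(p))` for every smooth `h`. -/
def oneForms (X : Type*) [DiffeologicalSpace X] :
    Submodule ℝ (∀ n : ℕ, {p : Euc n → X // IsPlot p} → Euc n → (Euc n →L[ℝ] ℝ)) where
  carrier := {η | (∀ n p, ContDiff ℝ ∞ (η n p)) ∧
    ∀ (m n : ℕ) (p : {p : Euc n → X // IsPlot p}) (h : Euc m → Euc n) (hh : ContDiff ℝ ∞ h)
      (u : Euc m),
      η m ⟨p.1 ∘ h, isPlot_reparam p.2 hh⟩ u = (η n p (h u)).comp (fderiv ℝ h u)}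
  add_mem' := by
    rintro a b ⟨ha, ha'⟩ ⟨hb, hb'⟩
    refine ⟨fun n p => (ha n p).add (hb n p), fun m n p h hh u => ?_⟩
    simp only [Pi.add_apply, ha' m n p h hh u, hb' m n p h hh u, ContinuousLinearMap.add_comp]
  zero_mem' := ⟨fun _ _ => contDiff_const, fun _ _ _ _ _ _ => by simp⟩
  smul_mem' := by
    rintro r a ⟨ha, ha'⟩
    refine ⟨fun n p => (ha n p).const_smul r, fun m n p h hh u => ?_⟩
    simp only [Pi.smul_apply, ha' m n p h hh u, ContinuousLinearMap.smul_comp]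

/-- `Ω¹(X)` as a vector space. -/
def Omega (X : Type*) [DiffeologicalSpace X] : Type _ := ↥(oneForms X)

variable {X Z : Type*} [DiffeologicalSpace X] [DiffeologicalSpace Z]

instance : AddCommGroup (Omega X) := inferInstanceAs (AddCommGroup ↥(oneForms X))

instance : Module ℝ (Omega X) := inferInstanceAs (Module ℝ ↥(oneForms X))

/-- The standard functional diffeology on `Ω¹(X)`: `φ` is a plot iff for every plot `p` of `X` the
map `(s, r) ↦ φ(s)(p)(r)` is smooth. -/
instance : DiffeologicalSpace (Omega X) := .ofCorePlotsOn {
  isPlotOn := fun {_ u} _ φ => ∀ (n : ℕ) (p : {p : Euc n → X // IsPlot p}),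
    ContDiffOn ℝ ∞ (fun z : _ × Euc n => (φ z.1).1 n p z.2) (u ×ˢ Set.univ)
  isPlotOn_congr := fun _ φ ψ h => by
    refine forall_congr' fun n => forall_congr' fun p => contDiffOn_congr ?_
    rintro ⟨s, r⟩ ⟨hs, -⟩
    simp only [h hs]
  isPlot := fun {_} φ => ∀ (n : ℕ) (p : {p : Euc n → X // IsPlot p}),
    ContDiff ℝ ∞ (fun z : _ × Euc n => (φ z.1).1 n p z.2)
  isPlotOn_univ := by simp [contDiffOn_univ]
  isPlot_const := fun η n p => (η.2.1 n p).comp contDiff_snd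
  isPlotOn_reparam := fun _ _ h hm hφ hh n p => by
    refine (hφ n p).comp (f := fun z : _ × Euc n => (h z.1, z.2))
      ((hh.comp contDiff_fst.contDiffOn fun z hz => hz.1).prodMk contDiff_snd.contDiffOn) ?_
    exact fun z hz => ⟨hm hz.1, trivial⟩
  locality := fun _ φ h n p z hz => by
    obtain ⟨v, hv, hzv, H⟩ := h z.1 hz.1
    exact ((H n p).contDiffAt ((hv.prod isOpen_univ).mem_nhds ⟨hzv, trivial⟩)).contDiffWithinAt }

/-- The pullback `h^* : Ω¹(Z) → Ω¹(X)` along a smooth map, `(h^*η)(p) = η(h ∘ p)`. -/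
def pullback (h : X → Z) (hh : DSmooth h) : Omega Z →ₗ[ℝ] Omega X where
  toFun η := Subtype.mk (fun n p => η.1 n ⟨h ∘ p.1, hh n p.1 p.2⟩)
    ⟨fun n _ => η.2.1 n _, fun m n p k hk u => η.2.2 m n ⟨h ∘ p.1, hh n p.1 p.2⟩ k hk u⟩
  map_add' _ _ := rfl
  map_smul' _ _ := rfl

/-- The 1-forms on `X` that vanish at `x`: `η(p)(0) = 0` for every plot `p` centered at `x`. -/
def vanishing (x : X) : Submodule ℝ (Omega X) where
  carrier := {η | ∀ (n : ℕ) (p : {p : Euc n → X // IsPlot p}), p.1 0 = x → η.1 n p 0 = 0}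
  add_mem' := fun ha hb n p hp =>
    (congrArg₂ (· + ·) (ha n p hp) (hb n p hp)).trans (add_zero 0)
  zero_mem' := fun _ _ _ => rfl
  smul_mem' := fun r _ ha n p hp =>
    (congrArg (r • ·) (ha n p hp)).trans (smul_zero r)

/-- The fibre `Λ¹ₓ(X)`, the space of values at `x` of 1-forms on `X`. -/
def Lam (X : Type*) [DiffeologicalSpace X] (x : X) : Type _ := Omega X ⧸ vanishing x

instance (x : X) : AddCommGroup (Lam X x) := inferInstanceAs (AddCommGroup (_ ⧸ vanishing x))

instance (x : X) : Module ℝ (Lam X x) := inferInstanceAs (Module ℝ (_ ⧸ vanishing x))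

/-- The value `η_x` of the form `η` at `x`. -/
def Lam.mk (x : X) : Omega X →ₗ[ℝ] Lam X x := (vanishing x).mkQ

/-- The diffeology of the total space `Λ¹(X)`: the pushforward of the product diffeology of
`X × Ω¹(X)` by `(x, η) ↦ (x, η_x)`. -/
instance : DiffeologicalSpace (Σ x : X, Lam X x) :=
  coinduced (fun q : X × Omega X => ⟨q.1, Lam.mk q.1 q.2⟩) inferInstance

/-- The map `Λ¹_z(Z) → Λ¹ₓ(X)` induced by the pullback of forms along a smooth `h` with
`h x = z`. -/
def pullbackAt (h : X → Z) (hh : DSmooth h) (x : X) (z : Z) (hz : h x = z) :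
    Lam Z z →ₗ[ℝ] Lam X x :=
  Submodule.mapQ (vanishing z) (vanishing x) (pullback h hh) fun η hη n p hp =>
    hη n ⟨h ∘ p.1, hh n p.1 p.2⟩ (by simp [hp, hz])

end Forms

/-! ### Diffeological vector pseudo-bundles, pseudo-metrics, Clifford actions

A pseudo-bundle `π : V → X` is given by its family of fibres `V x`, which are real vector spaces,
and by a diffeology on the total space `Σ x, V x`. -/

section PseudoBundles

variable {X : Type*} [DiffeologicalSpace X]

/-- Diffeological vector pseudo-bundle: projection, fibrewise addition `V ×_X V → V`, scalar
multiplication `ℝ × V → V` and zero section are smooth. The smoothness of a map defined on a fibre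
product is spelled out on plots; a plot of the fibre product is a pair of plots of the factors over
one and the same map to the base. -/
structure IsPseudoBundle (V : X → Type*) [∀ x, AddCommGroup (V x)] [∀ x, Module ℝ (V x)]
    (D : DiffeologicalSpace (Σ x, V x)) : Prop where
  proj : DSmooth (Sigma.fst : (Σ x, V x) → X)
  add : ∀ (n : ℕ) (p : Euc n → X) (v w : ∀ u, V (p u)),
    IsPlot (fun u => (⟨p u, v u⟩ : Σ x, V x)) → IsPlot (fun u => (⟨p u, w u⟩ : Σ x, V x)) →
    IsPlot (fun u => (⟨p u, v u + w u⟩ : Σ x, V x))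
  smul : ∀ (n : ℕ) (p : Euc n → X) (r : Euc n → ℝ) (v : ∀ u, V (p u)),
    IsPlot r → IsPlot (fun u => (⟨p u, v u⟩ : Σ x, V x)) →
    IsPlot (fun u => (⟨p u, r u • v u⟩ : Σ x, V x))
  zero : DSmooth (fun x => (⟨x, 0⟩ : Σ x, V x))

section Metrics

variable (V : X → Type*) [∀ x, AddCommGroup (V x)] [∀ x, Module ℝ (V x)]
  [DiffeologicalSpace (Σ x, V x)]

/-- The subset diffeology on the fibre `V x`. -/
@[reducible]
def fibreDiffeology (x : X) : DiffeologicalSpace (V x) :=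
  induced (fun v => (⟨x, v⟩ : Σ x, V x)) inferInstance

/-- The diffeological dual of the fibre `V x`: the space of its smooth linear functionals. -/
def smoothDual (x : X) : Submodule ℝ (V x →ₗ[ℝ] ℝ) where
  carrier := {φ | @DSmooth (V x) ℝ (fibreDiffeology V x) _ φ}
  add_mem' := fun ha hb n p hp =>
    ContDiff.isPlot ((IsPlot.contDiff (ha n p hp)).add (IsPlot.contDiff (hb n p hp)))
  zero_mem' := fun _ _ _ => isPlot_const
  smul_mem' := fun r _ ha n p hp =>
    ContDiff.isPlot (contDiff_const.mul (IsPlot.contDiff (ha n p hp)) (f := fun _ => r))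

variable {V}

/-- A pseudo-metric on a pseudo-bundle with finite-dimensional fibres: a family of symmetric
positive semidefinite bilinear forms on the fibres, which depends smoothly on the point (it is
smooth as a function on `V ×_X V`) and which has the maximal possible rank on each fibre, that is,
the multiplicity of its eigenvalue `0` is `dim V x - dim (V x)^*`. -/
structure IsPseudoMetric (g : ∀ x, LinearMap.BilinForm ℝ (V x)) : Prop where
  finite : ∀ x, FiniteDimensional ℝ (V x)
  symm : ∀ x v w, g x v w = g x w v
  nonneg : ∀ x v, 0 ≤ g x v v
  smooth : ∀ (n : ℕ) (p : Euc n → X) (v w : ∀ u, V (p u)),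
    IsPlot (fun u => (⟨p u, v u⟩ : Σ x, V x)) → IsPlot (fun u => (⟨p u, w u⟩ : Σ x, V x)) →
    IsPlot (fun u => g (p u) (v u) (w u))
  rank : ∀ x, Module.finrank ℝ (LinearMap.ker (g x)) + Module.finrank ℝ (smoothDual V x)
    = Module.finrank ℝ (V x)

end Metrics

section Clifford

variable {V : X → Type*} [∀ x, AddCommGroup (V x)] [∀ x, Module ℝ (V x)]

/-- The quadratic form `v ↦ -g(x)(v, v)`. -/
def cliffordForm (g : ∀ x, LinearMap.BilinForm ℝ (V x)) (x : X) : QuadraticForm ℝ (V x) :=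
  -(LinearMap.BilinMap.toQuadraticMap (g x))

/-- The fibre `Cl(V x, g x)`: the Clifford algebra with `v w + w v = -2 g(x)(v, w)`. -/
abbrev Cliff (g : ∀ x, LinearMap.BilinForm ℝ (V x)) (x : X) : Type _ :=
  CliffordAlgebra (cliffordForm g x)

/-- The properties of a diffeology on the total space of `Cl(V, g)` which make it a pseudo-bundle
of algebras (smooth fibrewise product, smooth unit section) into which `V` maps smoothly. -/
structure IsCliffordDiffeology [DiffeologicalSpace (Σ x, V x)]
    (g : ∀ x, LinearMap.BilinForm ℝ (V x)) (D : DiffeologicalSpace (Σ x, Cliff g x)) : Prop where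
  isPseudoBundle : IsPseudoBundle (Cliff g) D
  mul : ∀ (n : ℕ) (p : Euc n → X) (a b : ∀ u, Cliff g (p u)),
    IsPlot (fun u => (⟨p u, a u⟩ : Σ x, Cliff g x)) →
    IsPlot (fun u => (⟨p u, b u⟩ : Σ x, Cliff g x)) →
    IsPlot (fun u => (⟨p u, a u * b u⟩ : Σ x, Cliff g x))
  one : DSmooth (fun x => (⟨x, 1⟩ : Σ x, Cliff g x))
  ι : DSmooth (fun v : Σ x, V x =>
    (⟨v.1, CliffordAlgebra.ι (cliffordForm g v.1) v.2⟩ : Σ x, Cliff g x))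

/-- The diffeology of the pseudo-bundle of Clifford algebras `Cl(V, g)`, a quotient of the
pseudo-bundle of tensor algebras. It is the finest diffeology that makes `Cl(V, g)` a pseudo-bundle
of algebras with `V → Cl(V, g)` smooth; locally, its plots are the finite sums of products of plots
of `V` over the same plot of `X`, with smooth functions as coefficients. -/
instance cliffordDiffeology [DiffeologicalSpace (Σ x, V x)]
    (g : ∀ x, LinearMap.BilinForm ℝ (V x)) : DiffeologicalSpace (Σ x, Cliff g x) :=
  sInf {D | IsCliffordDiffeology g D}

variable {E : X → Type*} [∀ x, AddCommGroup (E x)] [∀ x, Module ℝ (E x)]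

/-- A fibrewise action `c` of `Cl(V, g)` on `E` by unital algebra homomorphisms
`Cl(V x, g x) → End(E x)` is smooth if the evaluation `(a, e) ↦ c(a)(e)` is smooth on
`Cl(V, g) ×_X E`. -/
def IsSmoothAction [DiffeologicalSpace (Σ x, V x)] [DiffeologicalSpace (Σ x, E x)]
    (g : ∀ x, LinearMap.BilinForm ℝ (V x))
    (c : ∀ x, Cliff g x →ₐ[ℝ] Module.End ℝ (E x)) : Prop :=
  ∀ (n : ℕ) (p : Euc n → X) (a : ∀ u, Cliff g (p u)) (e : ∀ u, E (p u)),
    IsPlot (fun u => (⟨p u, a u⟩ : Σ x, Cliff g x)) → IsPlot (fun u => (⟨p u, e u⟩ : Σ x, E x)) →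
    IsPlot (fun u => (⟨p u, c (p u) (a u) (e u)⟩ : Σ x, E x))

/-- The action `c` of `Cl(V, g)` on `E` is unitary with respect to `gE`: every `v` with
`g(x)(v, v) = 1` acts by preserving `gE(x)`. -/
def IsUnitaryAction (g : ∀ x, LinearMap.BilinForm ℝ (V x))
    (gE : ∀ x, LinearMap.BilinForm ℝ (E x))
    (c : ∀ x, Cliff g x →ₐ[ℝ] Module.End ℝ (E x)) : Prop :=
  ∀ (x : X) (v : V x), g x v v = 1 → ∀ e₁ e₂ : E x,
    gE x (c x (CliffordAlgebra.ι (cliffordForm g x) v) e₁)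
      (c x (CliffordAlgebra.ι (cliffordForm g x) v) e₂) = gE x e₁ e₂

end Clifford

end PseudoBundles

/-! ### Gluing of diffeological spaces -/

section Gluing

universe u₁ u₂ v

variable {X₁ : Type u₁} {X₂ : Type u₂} {Y : Set X₁}

/-- The set underlying `X₁ ∪_f X₂`, for `f : X₁ ⊇ Y → X₂`: it is the disjoint union of
`i₁(X₁ \ Y)` and of `i₂(X₂)`, that is, one representative is chosen in each class of the
equivalence relation on `X₁ ⊔ X₂` generated by `y ∼ f(y)` for `y ∈ Y`
(see `glueMk_surjective` and `glueMk_eq_iff`). -/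
inductive Glue (f : Y → X₂) : Type (max u₁ u₂)
  | left (x : X₁) (hx : x ∉ Y) : Glue f
  | right (x : X₂) : Glue f

open Classical in
/-- The quotient projection `X₁ ⊔ X₂ → X₁ ∪_f X₂`. -/
def glueMk (f : Y → X₂) : X₁ ⊕ X₂ → Glue f
  | .inl x => if h : x ∈ Y then .right (f ⟨x, h⟩) else .left x h
  | .inr x => .right x

/-- The relation `y ∼ f(y)` on `X₁ ⊔ X₂`. -/
inductive GlueRel (f : Y → X₂) : X₁ ⊕ X₂ → X₁ ⊕ X₂ → Prop
  | glue (y : Y) : GlueRel f (.inl y) (.inr (f y))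

theorem glueMk_inl_mem (f : Y → X₂) (y : Y) : glueMk f (.inl y) = .right (f y) := by
  simp [glueMk]

theorem glueMk_inl_not_mem (f : Y → X₂) (x : X₁) (hx : x ∉ Y) :
    glueMk f (.inl x) = .left x hx := by
  simp [glueMk, hx]

theorem glueMk_surjective (f : Y → X₂) : Function.Surjective (glueMk f) := by
  rintro (⟨x, hx⟩ | x)
  · exact ⟨.inl x, glueMk_inl_not_mem f x hx⟩
  · exact ⟨.inr x, rfl⟩

theorem glueMk_eq_iff (f : Y → X₂) (a b : X₁ ⊕ X₂) :
    glueMk f a = glueMk f b ↔ Relation.EqvGen (GlueRel f) a b := by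
  constructor
  · have key : ∀ y : Y, Relation.EqvGen (GlueRel f) (.inl y) (.inr (f y)) :=
      fun y => .rel _ _ (.glue y)
    intro h
    rcases a with a | a <;> rcases b with b | b
    · by_cases ha : a ∈ Y <;> by_cases hb : b ∈ Y <;> simp [glueMk, ha, hb] at h
      · exact .trans _ _ _ (key ⟨a, ha⟩) (h ▸ (key ⟨b, hb⟩).symm)
      · subst h; exact .refl _
    · by_cases ha : a ∈ Y <;> simp [glueMk, ha] at h
      exact h ▸ key ⟨a, ha⟩
    · by_cases hb : b ∈ Y <;> simp [glueMk, hb] at h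
      exact h ▸ (key ⟨b, hb⟩).symm
    · simp [glueMk] at h
      subst h; exact .refl _
  · intro h
    induction h with
    | rel _ _ h => obtain ⟨y⟩ := h; exact glueMk_inl_mem f y
    | refl => rfl
    | symm _ _ _ ih => exact ih.symm
    | trans _ _ _ _ _ ih₁ ih₂ => exact ih₁.trans ih₂

/-- The map `X₁ → X₁ ∪_f X₂`. -/
def incl₁ (f : Y → X₂) (x : X₁) : Glue f := glueMk f (.inl x)

/-- The inclusion `i₂ : X₂ → X₁ ∪_f X₂`. -/
def incl₂ (f : Y → X₂) (x : X₂) : Glue f := glueMk f (.inr x)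

theorem incl₁_of_mem {f : Y → X₂} {y : Y} {x : X₂} (h : f y = x) :
    incl₁ f (y : X₁) = .right x := h ▸ glueMk_inl_mem f y

theorem incl₁_of_not_mem (f : Y → X₂) (x : X₁) (hx : x ∉ Y) : incl₁ f x = .left x hx :=
  glueMk_inl_not_mem f x hx

variable [DiffeologicalSpace X₁] [DiffeologicalSpace X₂]

/-- The gluing diffeology on `X₁ ∪_f X₂`: the quotient of the disjoint union diffeology. -/
instance (f : Y → X₂) : DiffeologicalSpace (Glue f) := coinduced (glueMk f) inferInstance

theorem dSmooth_incl₁ (f : Y → X₂) : DSmooth (incl₁ f) :=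
  (dSmooth_coinduced (glueMk f)).comp dSmooth_inl

theorem dSmooth_incl₂ (f : Y → X₂) : DSmooth (incl₂ f) :=
  (dSmooth_coinduced (glueMk f)).comp dSmooth_inr

theorem dSmooth_val : DSmooth (Subtype.val : Y → X₁) := fun _ _ hp => hp

/-! ### 1-forms and gluing -/

/-- The map `ρ̃₁ : Λ¹_{z}(X₁ ∪_f X₂) → Λ¹_{x}(X₁)`, where `z` is the image of `x ∈ X₁`. -/
def rho₁ (f : Y → X₂) (x : X₁) (z : Glue f) (hz : incl₁ f x = z) :
    Lam (Glue f) z →ₗ[ℝ] Lam X₁ x :=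
  pullbackAt (incl₁ f) (dSmooth_incl₁ f) x z hz

/-- The map `ρ̃₂ : Λ¹_{i₂(x)}(X₁ ∪_f X₂) → Λ¹_{x}(X₂)`. -/
def rho₂ (f : Y → X₂) (x : X₂) : Lam (Glue f) (.right x) →ₗ[ℝ] Lam X₂ x :=
  pullbackAt (incl₂ f) (dSmooth_incl₂ f) x (.right x) rfl

/-- The condition `D₁^Ω = D₂^Ω`: the pushforward to `Ω¹(Y)` of the diffeology of `Ω¹(X₁)` by `i^*`
coincides with the pushforward of the diffeology of `Ω¹(X₂)` by `f^* j^* = (j ∘ f)^*`. -/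
def SamePushforward (f : Y → X₂) (hf : DSmooth f) : Prop :=
  coinduced (pullback (Subtype.val : Y → X₁) dSmooth_val) inferInstance =
    coinduced (pullback f hf) inferInstance

/-- `η₁ ∈ Ω¹(X₁)` and `η₂ ∈ Ω¹(X₂)` are compatible: `η₁(p) = η₂(f ∘ p)` for every plot `p` of the
subset diffeology of `Y`. -/
def CompatibleForms (f : Y → X₂) (hf : DSmooth f) (η₁ : Omega X₁) (η₂ : Omega X₂) : Prop :=
  pullback (Subtype.val : Y → X₁) dSmooth_val η₁ = pullback f hf η₂

/-- `α₁ ∈ Λ¹_y(X₁)` and `α₂ ∈ Λ¹_{f(y)}(X₂)` are compatible: the pair `(α₁, α₂)` is the value of a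
pair of compatible forms. -/
def CompatibleElements (f : Y → X₂) (hf : DSmooth f) (y : Y) (α₁ : Lam X₁ (y : X₁))
    (α₂ : Lam X₂ (f y)) : Prop :=
  ∃ (η₁ : Omega X₁) (η₂ : Omega X₂), CompatibleForms f hf η₁ η₂ ∧
    Lam.mk (y : X₁) η₁ = α₁ ∧ Lam.mk (f y) η₂ = α₂

/-- Compatibility of pseudo-metrics on `Λ¹(X₁)` and `Λ¹(X₂)` with the gluing along `f`. -/
def CompatibleLamMetrics (f : Y → X₂) (hf : DSmooth f)
    (g₁ : ∀ x, LinearMap.BilinForm ℝ (Lam X₁ x))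
    (g₂ : ∀ x, LinearMap.BilinForm ℝ (Lam X₂ x)) : Prop :=
  ∀ (y : Y) (α₁ β₁ : Lam X₁ (y : X₁)) (α₂ β₂ : Lam X₂ (f y)),
    CompatibleElements f hf y α₁ α₂ → CompatibleElements f hf y β₁ β₂ →
    g₁ y α₁ β₁ = g₂ (f y) α₂ β₂

open Classical in
/-- The pseudo-metric `g^Λ` on `Λ¹(X₁ ∪_f X₂)` induced by `g₁` and `g₂`: it is `g₁(ρ̃₁ ·, ρ̃₁ ·)`
over `i₁(X₁ \ Y)`, `g₂(ρ̃₂ ·, ρ̃₂ ·)` over `i₂(X₂ \ f(Y))`, and half the sum of the two over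
`i₂(f(Y))`. -/
def inducedLamMetric (f : Y → X₂) (g₁ : ∀ x, LinearMap.BilinForm ℝ (Lam X₁ x))
    (g₂ : ∀ x, LinearMap.BilinForm ℝ (Lam X₂ x)) :
    ∀ z : Glue f, LinearMap.BilinForm ℝ (Lam (Glue f) z)
  | .left x hx =>
      (g₁ x).compl₁₂ (rho₁ f x _ (incl₁_of_not_mem f x hx))
        (rho₁ f x _ (incl₁_of_not_mem f x hx))
  | .right x =>
      if h : ∃ y : Y, f y = x then
        (1 / 2 : ℝ) •
          ((g₁ h.choose).compl₁₂ (rho₁ f h.choose _ (incl₁_of_mem h.choose_spec))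
              (rho₁ f h.choose _ (incl₁_of_mem h.choose_spec))
            + (g₂ x).compl₁₂ (rho₂ f x) (rho₂ f x))
      else (g₂ x).compl₁₂ (rho₂ f x) (rho₂ f x)

/-- The elements `ρ̃₁(α)` and `ρ̃₂(α)` are compatible. -/
theorem compatible_rho (f : Y → X₂) (hf : DSmooth f) (y : Y)
    (α : Lam (Glue f) (.right (f y))) :
    CompatibleElements f hf y (rho₁ f y _ (incl₁_of_mem rfl) α) (rho₂ f (f y) α) := by
  obtain ⟨η, rfl⟩ := Submodule.Quotient.mk_surjective _ α
  refine ⟨pullback _ (dSmooth_incl₁ f) η, pullback _ (dSmooth_incl₂ f) η, ?_, rfl, rfl⟩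
  refine Subtype.ext (funext fun n => funext fun p => ?_)
  exact congrArg (η.1 n) (Subtype.ext (funext fun u => glueMk_inl_mem f (p.1 u)))

/-- Over `i₂(X₂)`, the compatibility of `g₁` and `g₂` gives `g^Λ = g₂(ρ̃₂ ·, ρ̃₂ ·)`. -/
theorem inducedLamMetric_right (f : Y → X₂) (hf : DSmooth f)
    (g₁ : ∀ x, LinearMap.BilinForm ℝ (Lam X₁ x)) (g₂ : ∀ x, LinearMap.BilinForm ℝ (Lam X₂ x))
    (hg : CompatibleLamMetrics f hf g₁ g₂) (x : X₂) (α β : Lam (Glue f) (.right x)) :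
    inducedLamMetric f g₁ g₂ (.right x) α β = g₂ x (rho₂ f x α) (rho₂ f x β) := by
  by_cases h : ∃ y : Y, f y = x
  · have key : ∀ (y : Y) (hy : f y = x),
        g₁ y (rho₁ f y _ (incl₁_of_mem hy) α) (rho₁ f y _ (incl₁_of_mem hy) β)
          = g₂ x (rho₂ f x α) (rho₂ f x β) := by
      rintro y rfl
      exact hg y _ _ _ _ (compatible_rho f hf y α) (compatible_rho f hf y β)
    have h' := key h.choose h.choose_spec
    simp only [inducedLamMetric, dif_pos h, LinearMap.smul_apply, LinearMap.add_apply,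
      LinearMap.compl₁₂_apply, h', smul_eq_mul]
    ring
  · simp [inducedLamMetric, dif_neg h]

/-! ### Gluing of pseudo-bundles -/

variable {E₁ : X₁ → Type v} {E₂ : X₂ → Type v}
  [∀ x, AddCommGroup (E₁ x)] [∀ x, Module ℝ (E₁ x)]
  [∀ x, AddCommGroup (E₂ x)] [∀ x, Module ℝ (E₂ x)]

/-- The map `χ₁⁻¹(Y) → E₂` of total spaces given by the fibrewise linear lift `F` of `f`. -/
def totalMap (f : Y → X₂) (F : ∀ y : Y, E₁ (y : X₁) →ₗ[ℝ] E₂ (f y))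
    (e : {e : Σ x, E₁ x // e.1 ∈ Y}) : Σ x, E₂ x :=
  ⟨f ⟨e.1.1, e.2⟩, F ⟨e.1.1, e.2⟩ e.1.2⟩

/-- The fibres of the glued pseudo-bundle `E₁ ∪_F E₂ → X₁ ∪_f X₂`: the fibre of `E₁` over points
of `i₁(X₁ \ Y)` and the fibre of `E₂` over points of `i₂(X₂)`. The total space is the quotient of
`E₁ ⊔ E₂` by the equivalence relation generated by `e ∼ F(e)` for `e ∈ χ₁⁻¹(Y)`
(see `glueBundleMk_surjective` and `glueBundleMk_eq_iff`). -/
def GlueFibre (f : Y → X₂) (_F : ∀ y : Y, E₁ (y : X₁) →ₗ[ℝ] E₂ (f y)) : Glue f → Type v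
  | .left x _ => E₁ x
  | .right x => E₂ x

instance (f : Y → X₂) (F : ∀ y : Y, E₁ (y : X₁) →ₗ[ℝ] E₂ (f y)) :
    ∀ z : Glue f, AddCommGroup (GlueFibre f F z)
  | .left x _ => inferInstanceAs (AddCommGroup (E₁ x))
  | .right x => inferInstanceAs (AddCommGroup (E₂ x))

instance (f : Y → X₂) (F : ∀ y : Y, E₁ (y : X₁) →ₗ[ℝ] E₂ (f y)) :
    ∀ z : Glue f, Module ℝ (GlueFibre f F z)
  | .left x _ => inferInstanceAs (Module ℝ (E₁ x))
  | .right x => inferInstanceAs (Module ℝ (E₂ x))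

open Classical in
/-- The quotient projection `E₁ ⊔ E₂ → E₁ ∪_F E₂`. -/
def glueBundleMk (f : Y → X₂) (F : ∀ y : Y, E₁ (y : X₁) →ₗ[ℝ] E₂ (f y)) :
    (Σ x, E₁ x) ⊕ (Σ x, E₂ x) → Σ z : Glue f, GlueFibre f F z
  | .inl e => if h : e.1 ∈ Y then ⟨.right (f ⟨e.1, h⟩), F ⟨e.1, h⟩ e.2⟩ else ⟨.left e.1 h, e.2⟩
  | .inr e => ⟨.right e.1, e.2⟩

theorem glueBundleMk_surjective (f : Y → X₂) (F : ∀ y : Y, E₁ (y : X₁) →ₗ[ℝ] E₂ (f y)) :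
    Function.Surjective (glueBundleMk f F) := by
  rintro ⟨⟨x, hx⟩ | x, e⟩
  · exact ⟨.inl ⟨x, e⟩, by simp [glueBundleMk, hx]⟩
  · exact ⟨.inr ⟨x, e⟩, rfl⟩

/-- Two elements of `E₁ ⊔ E₂` have the same image in `E₁ ∪_F E₂` iff they are identified by the
gluing of the sets `E₁` and `E₂` along `F : χ₁⁻¹(Y) → E₂`. -/
theorem glueBundleMk_eq_iff (f : Y → X₂) (F : ∀ y : Y, E₁ (y : X₁) →ₗ[ℝ] E₂ (f y))
    (a b : (Σ x, E₁ x) ⊕ (Σ x, E₂ x)) :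
    glueBundleMk f F a = glueBundleMk f F b ↔
      Relation.EqvGen (GlueRel (Y := {e : Σ x, E₁ x | e.1 ∈ Y}) (totalMap f F)) a b := by
  rw [← glueMk_eq_iff]
  have hL : ∀ (x : X₁) (hx : x ∉ Y) (e : E₁ x) (z : X₂) (e' : E₂ z),
      (⟨.left x hx, e⟩ : Σ z : Glue f, GlueFibre f F z) ≠ ⟨.right z, e'⟩ := by
    intro x hx e z e' h
    simpa using congrArg Sigma.fst h
  have hLL : ∀ (a b : Σ x, E₁ x) (ha : a.1 ∉ Y) (hb : b.1 ∉ Y),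
      (⟨.left a.1 ha, a.2⟩ : Σ z : Glue f, GlueFibre f F z) = ⟨.left b.1 hb, b.2⟩ ↔ a = b := by
    rintro ⟨x, e⟩ ⟨x', e'⟩ ha hb
    constructor
    · intro h
      obtain ⟨h1, h2⟩ := Sigma.mk.inj_iff.1 h
      obtain rfl : x = x' := by simpa using h1
      exact congrArg _ (eq_of_heq h2)
    · rintro h; cases h; rfl
  have hRR : ∀ (a b : Σ x, E₂ x),
      (⟨.right a.1, a.2⟩ : Σ z : Glue f, GlueFibre f F z) = ⟨.right b.1, b.2⟩ ↔ a = b := by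
    rintro ⟨x, e⟩ ⟨x', e'⟩
    constructor
    · intro h
      obtain ⟨h1, h2⟩ := Sigma.mk.inj_iff.1 h
      obtain rfl : x = x' := by simpa using h1
      exact congrArg _ (eq_of_heq h2)
    · rintro h; cases h; rfl
  have hT : ∀ (a : Σ x, E₁ x) (ha : a.1 ∈ Y),
      glueBundleMk f F (.inl a) =
        ⟨.right (totalMap f F ⟨a, ha⟩).1, (totalMap f F ⟨a, ha⟩).2⟩ := by
    intro a ha
    simp [glueBundleMk, ha, totalMap]
  have hN : ∀ (a : Σ x, E₁ x) (ha : a.1 ∉ Y), glueBundleMk f F (.inl a) = ⟨.left a.1 ha, a.2⟩ := by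
    intro a ha
    simp [glueBundleMk, ha]
  have hR : ∀ a : Σ x, E₂ x, glueBundleMk f F (.inr a) = ⟨.right a.1, a.2⟩ := fun _ => rfl
  rcases a with a | a <;> rcases b with b | b
  · by_cases ha : a.1 ∈ Y <;> by_cases hb : b.1 ∈ Y
    · rw [hT a ha, hT b hb, hRR]; simp [glueMk, ha, hb]
    · rw [hT a ha, hN b hb]; simp [glueMk, ha, hb, (hL _ _ _ _ _).symm]
    · rw [hN a ha, hT b hb]; simp [glueMk, ha, hb, hL]
    · rw [hN a ha, hN b hb, hLL]; simp [glueMk, ha, hb]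
  · by_cases ha : a.1 ∈ Y
    · rw [hT a ha, hR, hRR]; simp [glueMk, ha]
    · rw [hN a ha, hR]; simp [glueMk, ha, hL]
  · by_cases hb : b.1 ∈ Y
    · rw [hT b hb, hR, hRR]; simp [glueMk, hb]
    · rw [hN b hb, hR]; simp [glueMk, hb, (hL _ _ _ _ _).symm]
  · rw [hR, hR, hRR]; simp [glueMk]

/-- The gluing diffeology on the total space of `E₁ ∪_F E₂`. -/
instance [DiffeologicalSpace (Σ x, E₁ x)] [DiffeologicalSpace (Σ x, E₂ x)] (f : Y → X₂)
    (F : ∀ y : Y, E₁ (y : X₁) →ₗ[ℝ] E₂ (f y)) :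
    DiffeologicalSpace (Σ z : Glue f, GlueFibre f F z) :=
  coinduced (glueBundleMk f F) inferInstance

/-- Compatibility of pseudo-metrics on `E₁` and `E₂` with the gluing along `(F, f)`. -/
def CompatibleMetrics (f : Y → X₂) (F : ∀ y : Y, E₁ (y : X₁) →ₗ[ℝ] E₂ (f y))
    (g₁ : ∀ x, LinearMap.BilinForm ℝ (E₁ x)) (g₂ : ∀ x, LinearMap.BilinForm ℝ (E₂ x)) : Prop :=
  ∀ (y : Y) (v w : E₁ (y : X₁)), g₁ y v w = g₂ (f y) (F y v) (F y w)

/-- The induced pseudo-metric on `E₁ ∪_F E₂`. -/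
def inducedMetric (f : Y → X₂) (F : ∀ y : Y, E₁ (y : X₁) →ₗ[ℝ] E₂ (f y))
    (g₁ : ∀ x, LinearMap.BilinForm ℝ (E₁ x)) (g₂ : ∀ x, LinearMap.BilinForm ℝ (E₂ x)) :
    ∀ z : Glue f, LinearMap.BilinForm ℝ (GlueFibre f F z)
  | .left x _ => g₁ x
  | .right x => g₂ x

/-! ### Gluing of Clifford actions of 1-forms -/

variable {gΛ₁ : ∀ x, LinearMap.BilinForm ℝ (Lam X₁ x)}
  {gΛ₂ : ∀ x, LinearMap.BilinForm ℝ (Lam X₂ x)}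

/-- Compatibility of Clifford actions of `Cl(Λ¹(X₁), g₁)` on `E₁` and of `Cl(Λ¹(X₂), g₂)` on
`E₂`: `c₂(ρ̃₂(α))(F(e)) = F(c₁(ρ̃₁(α))(e))` for all `α` in the fibre of `Λ¹(X₁ ∪_f X₂)` over
`i₂(f(y))` and all `e` in the fibre of `E₁` over `y`. -/
def CompatibleActions (f : Y → X₂) (F : ∀ y : Y, E₁ (y : X₁) →ₗ[ℝ] E₂ (f y))
    (c₁ : ∀ x, Cliff gΛ₁ x →ₐ[ℝ] Module.End ℝ (E₁ x))
    (c₂ : ∀ x, Cliff gΛ₂ x →ₐ[ℝ] Module.End ℝ (E₂ x)) : Prop :=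
  ∀ (y : Y) (α : Lam (Glue f) (.right (f y))) (e : E₁ (y : X₁)),
    c₂ (f y) (CliffordAlgebra.ι _ (rho₂ f (f y) α)) (F y e) =
      F y (c₁ y (CliffordAlgebra.ι _ (rho₁ f y _ (incl₁_of_mem rfl) α)) e)

/-- The induced action of `Λ¹(X₁ ∪_f X₂)` on `E₁ ∪_F E₂`: `α` acts as `c₁(ρ̃₁(α))` over
`i₁(X₁ \ Y)` and as `c₂(ρ̃₂(α))` over `i₂(X₂)`. -/
def inducedLinearAction (f : Y → X₂) (F : ∀ y : Y, E₁ (y : X₁) →ₗ[ℝ] E₂ (f y))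
    (c₁ : ∀ x, Cliff gΛ₁ x →ₐ[ℝ] Module.End ℝ (E₁ x))
    (c₂ : ∀ x, Cliff gΛ₂ x →ₐ[ℝ] Module.End ℝ (E₂ x)) :
    ∀ z : Glue f, Lam (Glue f) z →ₗ[ℝ] Module.End ℝ (GlueFibre f F z)
  | .left x hx => (c₁ x).toLinearMap ∘ₗ CliffordAlgebra.ι (cliffordForm gΛ₁ x) ∘ₗ
      rho₁ f x _ (incl₁_of_not_mem f x hx)
  | .right x => (c₂ x).toLinearMap ∘ₗ CliffordAlgebra.ι (cliffordForm gΛ₂ x) ∘ₗ rho₂ f x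

theorem clifford_sq {V A : Type*} [AddCommGroup V] [Module ℝ V] [Ring A] [Algebra ℝ A]
    {Q : QuadraticForm ℝ V} (φ : CliffordAlgebra Q →ₐ[ℝ] A) (v : V) :
    φ (CliffordAlgebra.ι Q v) * φ (CliffordAlgebra.ι Q v) = algebraMap ℝ A (Q v) := by
  rw [← map_mul, CliffordAlgebra.ι_sq_scalar, AlgHom.commutes]

theorem inducedLinearAction_sq (f : Y → X₂) (hf : DSmooth f)
    (F : ∀ y : Y, E₁ (y : X₁) →ₗ[ℝ] E₂ (f y)) (hg : CompatibleLamMetrics f hf gΛ₁ gΛ₂)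
    (c₁ : ∀ x, Cliff gΛ₁ x →ₐ[ℝ] Module.End ℝ (E₁ x))
    (c₂ : ∀ x, Cliff gΛ₂ x →ₐ[ℝ] Module.End ℝ (E₂ x)) (z : Glue f) (α : Lam (Glue f) z) :
    inducedLinearAction f F c₁ c₂ z α * inducedLinearAction f F c₁ c₂ z α =
      algebraMap ℝ _ (cliffordForm (inducedLamMetric f gΛ₁ gΛ₂) z α) := by
  rcases z with ⟨x, hx⟩ | x
  · exact (clifford_sq (c₁ x) (rho₁ f x _ (incl₁_of_not_mem f x hx) α) :)
  · have h : cliffordForm (inducedLamMetric f gΛ₁ gΛ₂) (.right x) α =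
        cliffordForm gΛ₂ x (rho₂ f x α) := by
      simp [cliffordForm, inducedLamMetric_right f hf gΛ₁ gΛ₂ hg]
    rw [h]
    exact (clifford_sq (c₂ x) (rho₂ f x α) :)

/-- The induced Clifford action `c̃` of `Cl(Λ¹(X₁ ∪_f X₂), g^Λ)` on `E₁ ∪_F E₂`: the extension to
the Clifford algebras of the induced action of `Λ¹(X₁ ∪_f X₂)`. -/
def inducedAction (f : Y → X₂) (hf : DSmooth f)
    (F : ∀ y : Y, E₁ (y : X₁) →ₗ[ℝ] E₂ (f y)) (hg : CompatibleLamMetrics f hf gΛ₁ gΛ₂)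
    (c₁ : ∀ x, Cliff gΛ₁ x →ₐ[ℝ] Module.End ℝ (E₁ x))
    (c₂ : ∀ x, Cliff gΛ₂ x →ₐ[ℝ] Module.End ℝ (E₂ x)) (z : Glue f) :
    Cliff (inducedLamMetric f gΛ₁ gΛ₂) z →ₐ[ℝ] Module.End ℝ (GlueFibre f F z) :=
  CliffordAlgebra.lift _
    ⟨inducedLinearAction f F c₁ c₂ z, inducedLinearAction_sq f hf F hg c₁ c₂ z⟩

end Gluing

end DiffGluing

end

universe u₁ u₂ v

/-!
Everything is local on plots. The diffeologies of `X₁ ∪_f X₂` and of `E₁ ∪_F E₂` are quotients of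
disjoint unions, so that each plot lifts, near each point of its domain, to a plot of one of the
two pieces (`exists_lift_of_isPlot_coinduced_sum`). The passage between germs of plots and plots
defined on a whole Euclidean space uses smooth maps `r` with values in a given neighbourhood of
`x` and equal to the identity near `x` (`exists_contDiff_eventuallyEq_id`).

*The bundle and its metric.* Two plots of `E₁ ∪_F E₂` over the same map have local lifts to the
same piece: if one of them lifts to `E₂` and the other to `E₁`, the second lift lies over `Y`, and
`F`, being smooth, carries it to `E₂` (`exists_common_lift`). Smoothness of the operations and of
the metric is thus inherited from `E₁` and `E₂`. In the same way, plots with values in one fibre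
lift to `E₂` over `i₂(X₂)` and to `E₁` elsewhere: the fibres keep their diffeologies, hence their
smooth duals and the rank condition.

*The metric on `Λ¹`.* For a plot `p` centered at `x` the evaluation `η ↦ η(p)(0)(ξ)` is a smooth
functional on `Λ¹ₓ(X)`, and by the definition of vanishing forms these functionals separate
points. Therefore every functional on a finite-dimensional `Λ¹ₓ(X)` is smooth
(`finrank_smoothDual_lam`), and a pseudo-metric on `Λ¹(X)` is the same as a positive definite one.
Since plots lift locally, an element of `Λ¹_z(X₁ ∪_f X₂)` is zero if all its images under `ρ̃₁`
and `ρ̃₂` are (`lam_glue_eq_zero`); and compatibility says that `g^Λ` is `g₁(ρ̃₁ ·, ρ̃₁ ·)` over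
all of the image of `X₁` and `g₂(ρ̃₂ ·, ρ̃₂ ·)` over all of `i₂(X₂)`. So `g^Λ` is positive
definite, each single `ρ̃ᵢ` is injective, the fibres are finite-dimensional, and `g^Λ` is smooth.

*The action.* The action of `Λ¹(X₁ ∪_f X₂)` is smooth by the same local lifting. To pass to the
Clifford algebras (`isSmoothAction_of_ι`), the maps to the total space which act smoothly along
all reparametrizations are shown to form a Clifford diffeology; the diffeology of the Clifford
bundle, being the finest one, is contained in it. Unitarity is checked in each fibre, where the
metric and the action are pulled back by the same `ρ̃ᵢ`.
-/

noncomputable section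

namespace DiffGluing

open scoped Topology
open Filter

/-! ### Local lifting of plots -/

/-- Every neighbourhood `U` of `x` receives a smooth map from the whole Euclidean space which is the
identity near `x`: points are multiplied, relative to `x`, by a bump function supported in `U`.
Precomposition with this map turns local statements about plots into global ones. -/
theorem exists_contDiff_eventuallyEq_id {n : ℕ} {x : Euc n} {U : Set (Euc n)} (hU : U ∈ 𝓝 x) :
    ∃ r : Euc n → Euc n, ContDiff ℝ ∞ r ∧ (∀ u, r u ∈ U) ∧ r =ᶠ[𝓝 x] id := by
  obtain ⟨ε, hε, hεU⟩ := Metric.mem_nhds_iff.1 hU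
  let χ : ContDiffBump x := ⟨ε / 2, ε, half_pos hε, half_lt_self hε⟩
  refine ⟨fun u => x + χ u • (u - x), ?_, fun u => hεU ?_, ?_⟩
  · exact contDiff_const.add (χ.contDiff.smul (contDiff_id.sub contDiff_const))
  · rw [Metric.mem_ball, dist_eq_norm, add_sub_cancel_left, norm_smul, Real.norm_eq_abs,
      abs_of_nonneg χ.nonneg]
    by_cases hu : dist u x < ε
    · rw [dist_eq_norm] at hu
      exact (mul_le_of_le_one_left (norm_nonneg _) χ.le_one).trans_lt hu
    · rw [χ.zero_of_le_dist (not_lt.1 hu), zero_mul]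
      exact hε
  · filter_upwards [χ.eventuallyEq_one] with u hu
    simp [hu]

section

variable {A B C : Type*}

theorem isPlot_of_eventuallyEq [DiffeologicalSpace A] {n : ℕ} {p : Euc n → A}
    (h : ∀ x, ∃ q : Euc n → A, IsPlot q ∧ p =ᶠ[𝓝 x] q) : IsPlot p := by
  refine DiffeologicalSpace.locality fun x => ?_
  obtain ⟨q, hq, hpq⟩ := h x
  obtain ⟨U, hU, hUo, hxU⟩ := mem_nhds_iff.1 hpq
  refine ⟨U, hUo, hxU, fun {m k} hk hkc => ?_⟩
  have : p ∘ k = q ∘ k := funext fun u => hU (hk u)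
  rw [this]
  exact isPlot_reparam hq hkc

/-- The plots of the diffeology generated by a family which contains the constant maps and is
stable under smooth reparametrization are the maps that locally belong to this family. -/
theorem exists_eventuallyEq_of_isPlot_generateFrom {G : Set ((n : ℕ) × (Euc n → A))}
    (hconst : ∀ (n : ℕ) (a : A), (⟨n, fun _ => a⟩ : (n : ℕ) × (Euc n → A)) ∈ G)
    (hreparam : ∀ (m n : ℕ) (p : Euc n → A) (k : Euc m → Euc n), ContDiff ℝ ∞ k →
      (⟨n, p⟩ : (n : ℕ) × (Euc n → A)) ∈ G → (⟨m, p ∘ k⟩ : (n : ℕ) × (Euc n → A)) ∈ G)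
    {n : ℕ} {p : Euc n → A} (hp : @IsPlot A (.generateFrom G) n p) (x : Euc n) :
    ∃ q : Euc n → A, (⟨n, q⟩ : (n : ℕ) × (Euc n → A)) ∈ G ∧ p =ᶠ[𝓝 x] q := by
  let D : DiffeologicalSpace A :=
    { plots := fun n => {p | ∀ x, ∃ q : Euc n → A,
        (⟨n, q⟩ : (n : ℕ) × (Euc n → A)) ∈ G ∧ p =ᶠ[𝓝 x] q}
      constant_plots := fun a x => ⟨_, hconst _ a, EventuallyEq.rfl⟩
      plot_reparam := fun {m n p k} hp hk x => by
        obtain ⟨q, hq, hpq⟩ := hp (k x)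
        exact ⟨q ∘ k, hreparam _ _ _ _ hk hq, hpq.comp_tendsto hk.continuous.continuousAt⟩
      locality := fun {n p} h x => by
        obtain ⟨U, hUo, hxU, H⟩ := h x
        obtain ⟨r, hr, hrU, hrx⟩ := exists_contDiff_eventuallyEq_id (hUo.mem_nhds hxU)
        obtain ⟨q, hq, hpq⟩ := H hrU hr x
        refine ⟨q, hq, EventuallyEq.trans ?_ hpq⟩
        filter_upwards [hrx] with u hu
        simp [hu] }
  exact DiffeologicalSpace.le_iff'.1
    (DiffeologicalSpace.generateFrom_le_iff (d := D) |>.2 fun n p hp x => ⟨p, hp, EventuallyEq.rfl⟩)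
    n p hp x

theorem exists_lift_of_isPlot_coinduced {h : A → B} (hs : Function.Surjective h)
    {D : DiffeologicalSpace A} {n : ℕ} {p : Euc n → B} (hp : @IsPlot B (coinduced h D) n p)
    (x : Euc n) : ∃ q : Euc n → A, IsPlot q ∧ p =ᶠ[𝓝 x] h ∘ q := by
  have key := exists_eventuallyEq_of_isPlot_generateFrom
    (G := {q | ∃ p : Euc q.1 → A, IsPlot p ∧ q.2 = h ∘ p}) ?_ ?_ hp x
  · obtain ⟨q, ⟨q', hq', e⟩, hpq⟩ := key
    exact ⟨q', hq', hpq.trans (Eq.eventuallyEq e)⟩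
  · intro n b
    obtain ⟨a, rfl⟩ := hs b
    exact ⟨fun _ => a, isPlot_const, rfl⟩
  · rintro m n p k hk ⟨q, hq, e⟩
    exact ⟨q ∘ k, isPlot_reparam hq hk, congrArg (· ∘ k) e⟩

theorem exists_lift_of_isPlot_sum [DiffeologicalSpace A] [DiffeologicalSpace B] {n : ℕ}
    {p : Euc n → A ⊕ B} (hp : IsPlot p) (x : Euc n) :
    (∃ q : Euc n → A, IsPlot q ∧ p =ᶠ[𝓝 x] Sum.inl ∘ q) ∨
      ∃ q : Euc n → B, IsPlot q ∧ p =ᶠ[𝓝 x] Sum.inr ∘ q := by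
  have hp' : @IsPlot (A ⊕ B) (coinduced Sum.inl inferInstance ⊔ coinduced Sum.inr inferInstance)
    n p := hp
  rw [coinduced, coinduced, ← DiffeologicalSpace.generateFrom_union] at hp'
  have key := exists_eventuallyEq_of_isPlot_generateFrom ?_ ?_ hp' x
  · obtain ⟨q, ⟨q', hq', e⟩ | ⟨q', hq', e⟩, hpq⟩ := key
    · exact .inl ⟨q', hq', hpq.trans (Eq.eventuallyEq e)⟩
    · exact .inr ⟨q', hq', hpq.trans (Eq.eventuallyEq e)⟩
  · rintro n (a | b)
    · exact .inl ⟨fun _ => a, isPlot_const, rfl⟩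
    · exact .inr ⟨fun _ => b, isPlot_const, rfl⟩
  · rintro m n p k hk (⟨q, hq, e⟩ | ⟨q, hq, e⟩)
    · exact .inl ⟨q ∘ k, isPlot_reparam hq hk, congrArg (· ∘ k) e⟩
    · exact .inr ⟨q ∘ k, isPlot_reparam hq hk, congrArg (· ∘ k) e⟩

/-- A plot of a quotient of `A ⊔ B` lifts locally to a plot of `A` or to a plot of `B`. -/
theorem exists_lift_of_isPlot_coinduced_sum [DiffeologicalSpace A] [DiffeologicalSpace B]
    {h : A ⊕ B → C} (hs : Function.Surjective h) {n : ℕ} {p : Euc n → C}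
    (hp : @IsPlot C (coinduced h inferInstance) n p) (x : Euc n) :
    (∃ q : Euc n → A, IsPlot q ∧ ∀ᶠ u in 𝓝 x, p u = h (.inl (q u))) ∨
      ∃ q : Euc n → B, IsPlot q ∧ ∀ᶠ u in 𝓝 x, p u = h (.inr (q u)) := by
  obtain ⟨s, hs, hps⟩ := exists_lift_of_isPlot_coinduced hs hp x
  refine (exists_lift_of_isPlot_sum hs x).imp ?_ ?_ <;>
  · rintro ⟨q, hq, hsq⟩
    refine ⟨q, hq, ?_⟩
    filter_upwards [hps, hsq] with u h₁ h₂
    rw [h₁, Function.comp_apply, h₂, Function.comp_apply]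

end

section Sigma

variable {X : Type*} {V : X → Type*}

/-- A map to a total space which covers `a` is a section over `a`. -/
theorem exists_section_of_fst_eq {n : ℕ} (q : Euc n → Σ x, V x) (a : Euc n → X)
    (h : ∀ u, (q u).1 = a u) : ∃ t : ∀ u, V (a u), q = fun u => ⟨a u, t u⟩ := by
  obtain rfl : (fun u => (q u).1) = a := funext h
  exact ⟨fun u => (q u).2, rfl⟩

/-- Two plots of a total space which cover the same map near `u₀` agree near `u₀` with two plots
which cover the same map everywhere. -/
theorem exists_sections_of_fst_eventuallyEq [DiffeologicalSpace (Σ x, V x)] {n : ℕ}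
    {q q' : Euc n → Σ x, V x} (hq : IsPlot q) (hq' : IsPlot q') {u₀ : Euc n}
    (h : ∀ᶠ u in 𝓝 u₀, (q u).1 = (q' u).1) :
    ∃ (a : Euc n → X) (s t : ∀ u, V (a u)), IsPlot (fun u => (⟨a u, s u⟩ : Σ x, V x)) ∧
      IsPlot (fun u => (⟨a u, t u⟩ : Σ x, V x)) ∧
      ∀ᶠ u in 𝓝 u₀, q u = ⟨a u, s u⟩ ∧ q' u = ⟨a u, t u⟩ := by
  obtain ⟨r, hr, hrU, hr0⟩ := exists_contDiff_eventuallyEq_id h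
  obtain ⟨t, ht⟩ := exists_section_of_fst_eq (q' ∘ r) (fun u => (q (r u)).1) fun u => (hrU u).symm
  refine ⟨_, fun u => (q (r u)).2, t, isPlot_reparam hq hr, ht ▸ isPlot_reparam hq' hr, ?_⟩
  filter_upwards [hr0] with u hu
  have hu' : r u = u := hu
  rw [← congrFun ht u, Function.comp_apply, hu']
  exact ⟨rfl, rfl⟩

end Sigma

/-! ### Values of differential forms -/

section Forms

variable {X Z : Type*} [DiffeologicalSpace X] [DiffeologicalSpace Z]

/-- The value `η(p)(0)` depends only on the germ of the plot `p` at `0`. -/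
theorem oneForm_apply_zero_congr (η : Omega X) {n : ℕ} (p q : {p : Euc n → X // IsPlot p})
    (h : p.1 =ᶠ[𝓝 0] q.1) : η.1 n p 0 = η.1 n q 0 := by
  obtain ⟨r, hr, hrU, hr0⟩ := exists_contDiff_eventuallyEq_id h
  have key : ∀ p : {p : Euc n → X // IsPlot p},
      η.1 n ⟨p.1 ∘ r, isPlot_reparam p.2 hr⟩ 0 = η.1 n p 0 := by
    intro p
    rw [η.2.2 n n p r hr 0, hr0.fderiv_eq, hr0.eq_of_nhds, id, fderiv_id,
      ContinuousLinearMap.comp_id]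
  rw [← key p, ← key q]
  exact congrArg (fun p => η.1 n p 0) (Subtype.ext (funext hrU))

/-- The functional `η_x ↦ η(p)(0)(ξ)` on `Λ¹ₓ(X)` given by a plot `p` centered at `x` and by a
vector `ξ`. -/
def evalAt {x : X} {n : ℕ} (p : {p : Euc n → X // IsPlot p}) (hp : p.1 0 = x) (ξ : Euc n) :
    Lam X x →ₗ[ℝ] ℝ :=
  (vanishing x).liftQ
    { toFun := fun η : Omega X => η.1 n p 0 ξ
      map_add' := fun _ _ => rfl
      map_smul' := fun _ _ => rfl }
    fun η hη => by
      change η.1 n p 0 ξ = 0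
      rw [hη n p hp]
      rfl

theorem exists_lift_of_isPlot_lam {n : ℕ} {p : Euc n → Σ x : X, Lam X x} (hp : IsPlot p)
    (u₀ : Euc n) : ∃ (b : Euc n → X) (η : Euc n → Omega X), IsPlot b ∧ IsPlot η ∧
      ∀ᶠ u in 𝓝 u₀, p u = ⟨b u, Lam.mk (b u) (η u)⟩ := by
  have key := exists_lift_of_isPlot_coinduced
    (h := fun q : X × Omega X => (⟨q.1, Lam.mk q.1 q.2⟩ : Σ x, Lam X x)) ?_ hp u₀
  · obtain ⟨q, hq, hpq⟩ := key
    have hq' := DiffeologicalSpace.isPlot_inf_iff.1 hq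
    exact ⟨fun u => (q u).1, fun u => (q u).2, hq'.1, hq'.2, hpq⟩
  · rintro ⟨x, α⟩
    obtain ⟨η, rfl⟩ := Submodule.Quotient.mk_surjective _ α
    exact ⟨(x, η), rfl⟩

theorem isPlot_lam_mk {n : ℕ} {b : Euc n → X} {η : Euc n → Omega X} (hb : IsPlot b)
    (hη : IsPlot η) : IsPlot (fun u => (⟨b u, Lam.mk (b u) (η u)⟩ : Σ x, Lam X x)) :=
  isPlot_coinduced (fun q : X × Omega X => (⟨q.1, Lam.mk q.1 q.2⟩ : Σ x, Lam X x)) inferInstance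
    (p := fun u => (b u, η u)) (DiffeologicalSpace.isPlot_inf_iff.2 ⟨hb, hη⟩)

theorem evalAt_mem_smoothDual {x : X} {n : ℕ} (p : {p : Euc n → X // IsPlot p}) (hp : p.1 0 = x)
    (ξ : Euc n) : evalAt p hp ξ ∈ smoothDual (Lam X) x := by
  intro m γ hγ
  refine isPlot_of_eventuallyEq fun u₀ => ?_
  obtain ⟨b, η, -, hη, h⟩ := exists_lift_of_isPlot_lam hγ u₀
  refine ⟨fun u => (η u).1 n p 0 ξ, ?_, ?_⟩
  · have h1 : ContDiff ℝ ∞ fun z : Euc m × Euc n => (η z.1).1 n p z.2 := hη n p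
    exact ContDiff.isPlot ((h1.comp (contDiff_id.prodMk contDiff_const)).clm_apply contDiff_const)
  · filter_upwards [h] with u hu
    obtain ⟨h1, h2⟩ := Sigma.mk.inj_iff.1 hu
    have : ∀ (y : X) (hy : x = y) (α : Lam X x), α ≍ Lam.mk y (η u) →
        evalAt p hp ξ α = (η u).1 n p 0 ξ := by
      rintro _ rfl α hα
      obtain rfl := eq_of_heq hα
      rfl
    exact this _ h1 _ h2

theorem lam_eq_zero_of_evalAt {x : X} (α : Lam X x)
    (h : ∀ (n : ℕ) (p : {p : Euc n → X // IsPlot p}) (hp : p.1 0 = x) (ξ : Euc n),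
      evalAt p hp ξ α = 0) : α = 0 := by
  obtain ⟨η, rfl⟩ := Submodule.Quotient.mk_surjective _ α
  refine (Submodule.Quotient.mk_eq_zero _).2 fun n p hp => ?_
  exact ContinuousLinearMap.ext fun ξ => h n p hp ξ

/-- Point evaluations are smooth and separate the elements of `Λ¹ₓ(X)`; hence all the linear
functionals on `Λ¹ₓ(X)` are smooth if this space is finite-dimensional. -/
theorem finrank_smoothDual_lam (x : X) [FiniteDimensional ℝ (Lam X x)] :
    Module.finrank ℝ (smoothDual (Lam X) x) = Module.finrank ℝ (Lam X x) := by
  have h : Submodule.dualCoannihilator (smoothDual (Lam X) x) = ⊥ := by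
    refine (Submodule.eq_bot_iff _).2 fun α hα => lam_eq_zero_of_evalAt α fun n p hp ξ => ?_
    exact (Submodule.mem_dualCoannihilator _).1 hα _ (evalAt_mem_smoothDual p hp ξ)
  have := Subspace.finrank_add_finrank_dualCoannihilator_eq (smoothDual (Lam X) x)
  rw [h, finrank_bot] at this
  exact this

/-- Pseudo-metrics on `Λ¹(X)` are positive definite. -/
theorem IsPseudoMetric.lam_eq_zero {g : ∀ x, LinearMap.BilinForm ℝ (Lam X x)}
    (hg : IsPseudoMetric g) {x : X} {α : Lam X x} (h : g x α α = 0) : α = 0 := by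
  have := hg.finite x
  have h0 : LinearMap.ker (g x) = ⊥ := by
    have := hg.rank x
    rw [finrank_smoothDual_lam] at this
    exact Submodule.finrank_eq_zero.1 (by omega)
  have hα :=
    (LinearMap.BilinForm.apply_apply_same_eq_zero_iff (g x) (hg.nonneg x) ⟨hg.symm x⟩).1 h
  rw [h0] at hα
  exact (Submodule.mem_bot ℝ).1 hα

theorem dSmooth_lam_fst : DSmooth (Sigma.fst : (Σ x : X, Lam X x) → X) := by
  intro n p hp
  refine isPlot_of_eventuallyEq fun u₀ => ?_
  obtain ⟨b, η, hb, -, h⟩ := exists_lift_of_isPlot_lam hp u₀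
  exact ⟨b, hb, h.mono fun u hu => congrArg Sigma.fst hu⟩

theorem dSmooth_pullback {h : X → Z} (hh : DSmooth h) : DSmooth (pullback h hh) :=
  fun _ _ hη n p => hη n ⟨h ∘ p.1, hh n p.1 p.2⟩

/-- If a plot `p` of `Z` lifts near `u₀` along `h` to a plot `a` of `X`, then plots of `Λ¹(Z)` over
`p` pull back near `u₀` to plots of `Λ¹(X)` over `a`. -/
theorem exists_isPlot_pullbackAt {h : X → Z} (hh : DSmooth h) {n : ℕ} {p : Euc n → Z}
    {α : ∀ u, Lam Z (p u)} (hα : IsPlot fun u => (⟨p u, α u⟩ : Σ z, Lam Z z)) {a : Euc n → X}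
    (ha : IsPlot a) (u₀ : Euc n) :
    ∃ β : ∀ u, Lam X (a u), IsPlot (fun u => (⟨a u, β u⟩ : Σ x, Lam X x)) ∧
      ∀ᶠ u in 𝓝 u₀, ∀ hz : h (a u) = p u, pullbackAt h hh (a u) (p u) hz (α u) = β u := by
  obtain ⟨b, η, -, hη, hb⟩ := exists_lift_of_isPlot_lam hα u₀
  refine ⟨fun u => Lam.mk (a u) (pullback h hh (η u)),
    isPlot_lam_mk ha (dSmooth_pullback hh _ _ hη), ?_⟩
  filter_upwards [hb] with u hu hz
  have key : ∀ (z z' : Z) (hz : h (a u) = z) (α : Lam Z z),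
      (⟨z, α⟩ : Σ z, Lam Z z) = ⟨z', Lam.mk z' (η u)⟩ →
      pullbackAt h hh (a u) z hz α = Lam.mk (a u) (pullback h hh (η u)) := by
    rintro z z' hz α e
    cases e
    rfl
  exact key _ _ hz _ hu

end Forms

/-! ### Smoothness of Clifford actions -/

section Clifford

variable {X : Type*} [DiffeologicalSpace X]
  {V : X → Type*} [∀ x, AddCommGroup (V x)] [∀ x, Module ℝ (V x)] [DiffeologicalSpace (Σ x, V x)]
  {E : X → Type*} [∀ x, AddCommGroup (E x)] [∀ x, Module ℝ (E x)]
  [D : DiffeologicalSpace (Σ x, E x)]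

/-- A smooth Clifford action restricts to a smooth action of `V`. -/
theorem IsSmoothAction.isPlot_ι {g : ∀ x, LinearMap.BilinForm ℝ (V x)}
    {c : ∀ x, Cliff g x →ₐ[ℝ] Module.End ℝ (E x)} (hc : IsSmoothAction g c) {n : ℕ}
    {p : Euc n → X} {v : ∀ u, V (p u)} {e : ∀ u, E (p u)}
    (hv : IsPlot fun u => (⟨p u, v u⟩ : Σ x, V x)) (he : IsPlot fun u => (⟨p u, e u⟩ : Σ x, E x)) :
    IsPlot fun u => (⟨p u, c (p u) (CliffordAlgebra.ι _ (v u)) (e u)⟩ : Σ x, E x) :=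
  hc n p _ e (DiffeologicalSpace.isPlot_sInf_iff.2 fun _ hD => hD.ι n _ hv) he

/-- A fixed element of the Clifford algebra acts smoothly if the elements of `V` do. -/
theorem isPlot_action_const (hE : IsPseudoBundle E D) {g : ∀ x, LinearMap.BilinForm ℝ (V x)}
    {c : ∀ x, Cliff g x →ₐ[ℝ] Module.End ℝ (E x)}
    (hc : ∀ (n : ℕ) (p : Euc n → X) (v : ∀ u, V (p u)) (e : ∀ u, E (p u)),
      IsPlot (fun u => (⟨p u, v u⟩ : Σ x, V x)) → IsPlot (fun u => (⟨p u, e u⟩ : Σ x, E x)) →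
      IsPlot (fun u => (⟨p u, c (p u) (CliffordAlgebra.ι _ (v u)) (e u)⟩ : Σ x, E x)))
    {x : X} (a : Cliff g x) {n : ℕ} (e : Euc n → E x)
    (he : IsPlot (fun u => (⟨x, e u⟩ : Σ x, E x))) :
    IsPlot (fun u => (⟨x, c x a (e u)⟩ : Σ x, E x)) := by
  induction a using CliffordAlgebra.induction generalizing e with
  | algebraMap r =>
    simp only [AlgHom.commutes, Module.algebraMap_end_apply]
    exact hE.smul n (fun _ => x) (fun _ => r) e isPlot_const he
  | ι v => exact hc n (fun _ => x) (fun _ => v) e isPlot_const he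
  | mul a b ha hb =>
    simp only [map_mul, Module.End.mul_apply]
    exact ha _ (hb _ he)
  | add a b ha hb =>
    simp only [map_add, LinearMap.add_apply]
    exact hE.add n (fun _ => x) _ _ (ha _ he) (hb _ he)

/-- The diffeology on the total space of `Cl(V, g)` whose plots are the maps that act smoothly
along each smooth reparametrization. -/
@[reducible]
def actionDiffeology (hE : IsPseudoBundle E D) {g : ∀ x, LinearMap.BilinForm ℝ (V x)}
    {c : ∀ x, Cliff g x →ₐ[ℝ] Module.End ℝ (E x)}
    (hc : ∀ (n : ℕ) (p : Euc n → X) (v : ∀ u, V (p u)) (e : ∀ u, E (p u)),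
      IsPlot (fun u => (⟨p u, v u⟩ : Σ x, V x)) → IsPlot (fun u => (⟨p u, e u⟩ : Σ x, E x)) →
      IsPlot (fun u => (⟨p u, c (p u) (CliffordAlgebra.ι _ (v u)) (e u)⟩ : Σ x, E x))) :
    DiffeologicalSpace (Σ x, Cliff g x) where
  plots n := {q | IsPlot (fun u => (q u).1) ∧
    ∀ (m : ℕ) (k : Euc m → Euc n), ContDiff ℝ ∞ k → ∀ e : ∀ u, E (q (k u)).1,
      IsPlot (fun u => (⟨(q (k u)).1, e u⟩ : Σ x, E x)) →
      IsPlot (fun u => (⟨(q (k u)).1, c _ (q (k u)).2 (e u)⟩ : Σ x, E x))}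
  constant_plots a := ⟨isPlot_const, fun _ _ _ e he => isPlot_action_const hE hc a.2 e he⟩
  plot_reparam := fun {_ _ _ k} hq hk =>
    ⟨isPlot_reparam hq.1 hk, fun m l hl e he => hq.2 m (k ∘ l) (hk.comp hl) e he⟩
  locality := fun {n q} h => by
    refine ⟨DiffeologicalSpace.locality fun x => ?_, fun m k hk e he => ?_⟩
    · obtain ⟨U, hUo, hxU, H⟩ := h x
      exact ⟨U, hUo, hxU, fun hl hlc => (H hl hlc).1⟩
    · refine isPlot_of_eventuallyEq fun u₀ => ?_
      obtain ⟨U, hUo, hxU, H⟩ := h (k u₀)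
      obtain ⟨r, hr, hrU, hr0⟩ := exists_contDiff_eventuallyEq_id
        (hk.continuous.continuousAt.preimage_mem_nhds (hUo.mem_nhds hxU))
      refine ⟨_, (H hrU (hk.comp hr)).2 m id contDiff_id (fun u => e (r u))
        (isPlot_reparam he hr), ?_⟩
      filter_upwards [hr0] with u hu
      exact (congrArg (fun w => (⟨(q (k w)).1, c _ (q (k w)).2 (e w)⟩ : Σ x, E x)) hu).symm

/-- The Clifford action that extends a smooth action of `V` is smooth. The diffeology of `Cl(V, g)`
is the finest Clifford diffeology, so that it suffices to find one for which `Cl(V, g)` acts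
smoothly: the maps that act smoothly are the plots of such a diffeology. -/
theorem isSmoothAction_of_ι (hE : IsPseudoBundle E D) {g : ∀ x, LinearMap.BilinForm ℝ (V x)}
    {c : ∀ x, Cliff g x →ₐ[ℝ] Module.End ℝ (E x)}
    (hV : DSmooth (Sigma.fst : (Σ x, V x) → X))
    (hc : ∀ (n : ℕ) (p : Euc n → X) (v : ∀ u, V (p u)) (e : ∀ u, E (p u)),
      IsPlot (fun u => (⟨p u, v u⟩ : Σ x, V x)) → IsPlot (fun u => (⟨p u, e u⟩ : Σ x, E x)) →
      IsPlot (fun u => (⟨p u, c (p u) (CliffordAlgebra.ι _ (v u)) (e u)⟩ : Σ x, E x))) :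
    IsSmoothAction g c := by
  have hD : IsCliffordDiffeology g (actionDiffeology hE hc) := by
    refine @IsCliffordDiffeology.mk _ _ _ _ _ _ _ _ (@IsPseudoBundle.mk _ _ _ _ _ _ ?_ ?_ ?_ ?_)
      ?_ ?_ ?_
    · exact fun n q hq => hq.1
    · refine fun n p a b ha hb => ⟨ha.1, fun m k hk e he => ?_⟩
      simp only [map_add, LinearMap.add_apply]
      exact hE.add m (fun u => p (k u)) _ _ (ha.2 m k hk e he) (hb.2 m k hk e he)
    · refine fun n p r a hr ha => ⟨ha.1, fun m k hk e he => ?_⟩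
      simp only [map_smul, LinearMap.smul_apply]
      exact hE.smul m (fun u => p (k u)) (fun u => r (k u)) _ (isPlot_reparam hr hk)
        (ha.2 m k hk e he)
    · refine fun n p hp => ⟨hp, fun m k hk e he => ?_⟩
      simp only [Function.comp_apply, map_zero, LinearMap.zero_apply]
      exact hE.zero m (fun u => p (k u)) (isPlot_reparam hp hk)
    · refine fun n p a b ha hb => ⟨ha.1, fun m k hk e he => ?_⟩
      simp only [map_mul, Module.End.mul_apply]
      exact ha.2 m k hk _ (hb.2 m k hk e he)
    · refine fun n p hp => ⟨hp, fun m k hk e he => ?_⟩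
      simp only [Function.comp_apply, map_one, Module.End.one_apply]
      exact he
    · exact fun n v hv => ⟨hV n v hv, fun m k hk e he =>
        hc m (fun u => (v (k u)).1) (fun u => (v (k u)).2) e (isPlot_reparam hv hk) he⟩
  intro n p a e ha he
  exact (DiffeologicalSpace.isPlot_sInf_iff.1 ha _ hD).2 n id contDiff_id e he

end Clifford

/-! ### The pseudo-metric on the values of 1-forms on a glued space -/

section GlueBase

variable {X₁ X₂ : Type*} {Y : Set X₁} {f : Y → X₂}

theorem eq_of_incl₁_eq (hf : Function.Injective f) {x x' : X₁} (h : incl₁ f x = incl₁ f x') :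
    x = x' := by
  by_cases hx : x ∈ Y <;> by_cases hx' : x' ∈ Y <;>
    simp only [incl₁, glueMk, hx, hx', dif_pos, dif_neg, not_false_eq_true, reduceCtorEq,
      Glue.right.injEq, Glue.left.injEq] at h
  · exact congrArg Subtype.val (hf h)
  · exact h

theorem mem_of_incl₁_eq_right {x : X₁} {x' : X₂} (h : incl₁ f x = .right x') : x ∈ Y := by
  by_contra hx
  simp [incl₁_of_not_mem f x hx] at h

variable [DiffeologicalSpace X₁] [DiffeologicalSpace X₂]

/-- A plot of `X₁ ∪_f X₂` lifts locally to a plot of `X₁` or to a plot of `X₂`. -/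
theorem exists_lift_of_isPlot_glue {n : ℕ} {p : Euc n → Glue f} (hp : IsPlot p) (u₀ : Euc n) :
    (∃ a : Euc n → X₁, IsPlot a ∧ ∀ᶠ u in 𝓝 u₀, incl₁ f (a u) = p u) ∨
      ∃ a : Euc n → X₂, IsPlot a ∧ ∀ᶠ u in 𝓝 u₀, incl₂ f (a u) = p u := by
  refine (exists_lift_of_isPlot_coinduced_sum (glueMk_surjective f) hp u₀).imp ?_ ?_ <;>
  · rintro ⟨a, ha, h⟩
    exact ⟨a, ha, h.mono fun _ => Eq.symm⟩

/-- A value at `z` of a form on `X₁ ∪_f X₂` is zero as soon as its pullbacks to all the points of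
`X₁` and of `X₂` over `z` are zero, since the plots centered at `z` lift near `0`. -/
theorem lam_glue_eq_zero {z : Glue f} (α : Lam (Glue f) z)
    (h₁ : ∀ (x : X₁) (hz : incl₁ f x = z), rho₁ f x z hz α = 0)
    (h₂ : ∀ (x : X₂) (hz : incl₂ f x = z),
      pullbackAt (incl₂ f) (dSmooth_incl₂ f) x z hz α = 0) : α = 0 := by
  obtain ⟨η, rfl⟩ := Submodule.Quotient.mk_surjective _ α
  refine (Submodule.Quotient.mk_eq_zero _).2 fun n p hp => ?_
  rcases exists_lift_of_isPlot_glue p.2 0 with ⟨a, ha, h⟩ | ⟨a, ha, h⟩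
  · rw [oneForm_apply_zero_congr η p ⟨incl₁ f ∘ a, dSmooth_incl₁ f n a ha⟩
      (h.mono fun _ => Eq.symm)]
    exact (Submodule.Quotient.mk_eq_zero _).1 (h₁ (a 0) (h.self_of_nhds.trans hp)) n ⟨a, ha⟩ rfl
  · rw [oneForm_apply_zero_congr η p ⟨incl₂ f ∘ a, dSmooth_incl₂ f n a ha⟩
      (h.mono fun _ => Eq.symm)]
    exact (Submodule.Quotient.mk_eq_zero _).1 (h₂ (a 0) (h.self_of_nhds.trans hp)) n ⟨a, ha⟩ rfl

variable {g₁ : ∀ x, LinearMap.BilinForm ℝ (Lam X₁ x)} {g₂ : ∀ x, LinearMap.BilinForm ℝ (Lam X₂ x)}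

/-- By compatibility, `g^Λ = g₁(ρ̃₁ ·, ρ̃₁ ·)` over the whole image of `X₁`. -/
theorem inducedLamMetric_incl₁ (hf : DSmooth f) (hg : CompatibleLamMetrics f hf g₁ g₂) (x : X₁)
    (z : Glue f) (hz : incl₁ f x = z) (α β : Lam (Glue f) z) :
    inducedLamMetric f g₁ g₂ z α β = g₁ x (rho₁ f x z hz α) (rho₁ f x z hz β) := by
  by_cases hx : x ∈ Y
  · obtain rfl : Glue.right (f ⟨x, hx⟩) = z := (glueMk_inl_mem f ⟨x, hx⟩).symm.trans hz
    rw [inducedLamMetric_right f hf g₁ g₂ hg]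
    exact (hg ⟨x, hx⟩ _ _ _ _ (compatible_rho f hf ⟨x, hx⟩ α)
      (compatible_rho f hf ⟨x, hx⟩ β)).symm
  · obtain rfl : Glue.left x hx = z := (incl₁_of_not_mem f x hx).symm.trans hz
    rfl

theorem inducedLamMetric_incl₂ (hf : DSmooth f) (hg : CompatibleLamMetrics f hf g₁ g₂) (x : X₂)
    (z : Glue f) (hz : incl₂ f x = z) (α β : Lam (Glue f) z) :
    inducedLamMetric f g₁ g₂ z α β =
      g₂ x (pullbackAt (incl₂ f) (dSmooth_incl₂ f) x z hz α)
        (pullbackAt (incl₂ f) (dSmooth_incl₂ f) x z hz β) := by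
  subst hz
  exact inducedLamMetric_right f hf g₁ g₂ hg x α β

/-- `g^Λ` is positive definite because `g₁` and `g₂` are, and because `ρ̃₁` and `ρ̃₂` are jointly
injective. -/
theorem inducedLamMetric_eq_zero (hf : DSmooth f) (hg : CompatibleLamMetrics f hf g₁ g₂)
    (hg₁ : IsPseudoMetric g₁) (hg₂ : IsPseudoMetric g₂) {z : Glue f} {α : Lam (Glue f) z}
    (h : inducedLamMetric f g₁ g₂ z α α = 0) : α = 0 :=
  lam_glue_eq_zero α
    (fun x hz => hg₁.lam_eq_zero (by rw [← inducedLamMetric_incl₁ hf hg, h]))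
    (fun x hz => hg₂.lam_eq_zero (by rw [← inducedLamMetric_incl₂ hf hg, h]))

theorem isPseudoMetric_inducedLamMetric (hf : DSmooth f) (hg : CompatibleLamMetrics f hf g₁ g₂)
    (hg₁ : IsPseudoMetric g₁) (hg₂ : IsPseudoMetric g₂) :
    IsPseudoMetric (inducedLamMetric f g₁ g₂) := by
  -- A single map `ρ̃ᵢ` is already injective: `ρ̃ᵢ α = 0` implies `g^Λ(α, α) = 0`.
  have hfin : ∀ z, FiniteDimensional ℝ (Lam (Glue f) z) := by
    intro z
    obtain ⟨x | x, hx⟩ := glueMk_surjective f z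
    · have := hg₁.finite x
      refine FiniteDimensional.of_injective (rho₁ f x z hx)
        ((injective_iff_map_eq_zero _).2 fun α hα =>
          inducedLamMetric_eq_zero hf hg hg₁ hg₂ ?_)
      rw [inducedLamMetric_incl₁ hf hg x z hx, hα, map_zero]
    · have := hg₂.finite x
      refine FiniteDimensional.of_injective (pullbackAt (incl₂ f) (dSmooth_incl₂ f) x z hx)
        ((injective_iff_map_eq_zero _).2 fun α hα =>
          inducedLamMetric_eq_zero hf hg hg₁ hg₂ ?_)
      rw [inducedLamMetric_incl₂ hf hg x z hx, hα, map_zero]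
  refine ⟨hfin, fun z α β => ?_, fun z α => ?_, fun n p α β hα hβ => ?_, fun z => ?_⟩
  · obtain ⟨x | x, hx⟩ := glueMk_surjective f z
    · simp only [inducedLamMetric_incl₁ hf hg x z hx, hg₁.symm x (rho₁ f x z hx α)]
    · simp only [inducedLamMetric_incl₂ hf hg x z hx,
        hg₂.symm x (pullbackAt (incl₂ f) (dSmooth_incl₂ f) x z hx α)]
  · obtain ⟨x | x, hx⟩ := glueMk_surjective f z
    · simpa only [inducedLamMetric_incl₁ hf hg x z hx] using hg₁.nonneg x _
    · simpa only [inducedLamMetric_incl₂ hf hg x z hx] using hg₂.nonneg x _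
  · refine isPlot_of_eventuallyEq fun u₀ => ?_
    have hp : IsPlot p := dSmooth_lam_fst n _ hα
    rcases exists_lift_of_isPlot_glue hp u₀ with ⟨a, ha, h⟩ | ⟨a, ha, h⟩
    · obtain ⟨α', hα', h'⟩ := exists_isPlot_pullbackAt (dSmooth_incl₁ f) hα ha u₀
      obtain ⟨β', hβ', h''⟩ := exists_isPlot_pullbackAt (dSmooth_incl₁ f) hβ ha u₀
      refine ⟨_, hg₁.smooth n a α' β' hα' hβ', ?_⟩
      filter_upwards [h, h', h''] with u hu hu' hu''
      rw [inducedLamMetric_incl₁ hf hg (a u) (p u) hu, ← hu' hu, ← hu'' hu]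
      rfl
    · obtain ⟨α', hα', h'⟩ := exists_isPlot_pullbackAt (dSmooth_incl₂ f) hα ha u₀
      obtain ⟨β', hβ', h''⟩ := exists_isPlot_pullbackAt (dSmooth_incl₂ f) hβ ha u₀
      refine ⟨_, hg₂.smooth n a α' β' hα' hβ', ?_⟩
      filter_upwards [h, h', h''] with u hu hu' hu''
      rw [inducedLamMetric_incl₂ hf hg (a u) (p u) hu, ← hu' hu, ← hu'' hu]
  · have := hfin z
    have hker : LinearMap.ker (inducedLamMetric f g₁ g₂ z) = ⊥ := by
      refine (Submodule.eq_bot_iff _).2 fun α hα => inducedLamMetric_eq_zero hf hg hg₁ hg₂ ?_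
      rw [LinearMap.mem_ker.1 hα, LinearMap.zero_apply]
    rw [hker, finrank_bot, finrank_smoothDual_lam, zero_add]

end GlueBase

/-! ### Gluing of pseudo-bundles -/

section GlueBundle

variable {X₁ : Type u₁} {X₂ : Type u₂} {Y : Set X₁} {f : Y → X₂}
  {E₁ : X₁ → Type v} {E₂ : X₂ → Type v}
  [∀ x, AddCommGroup (E₁ x)] [∀ x, Module ℝ (E₁ x)]
  [∀ x, AddCommGroup (E₂ x)] [∀ x, Module ℝ (E₂ x)]
  {F : ∀ y : Y, E₁ (y : X₁) →ₗ[ℝ] E₂ (f y)}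

theorem glueBundleMk_inl_mem {x : X₁} (hx : x ∈ Y) (e : E₁ x) :
    glueBundleMk f F (.inl ⟨x, e⟩) = ⟨.right (f ⟨x, hx⟩), F ⟨x, hx⟩ e⟩ :=
  dif_pos hx

theorem glueBundleMk_inl_not_mem {x : X₁} (hx : x ∉ Y) (e : E₁ x) :
    glueBundleMk f F (.inl ⟨x, e⟩) = ⟨.left x hx, e⟩ :=
  dif_neg hx

theorem glueBundleMk_inl_fst (e : Σ x, E₁ x) : (glueBundleMk f F (.inl e)).1 = incl₁ f e.1 := by
  by_cases he : e.1 ∈ Y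
  · rw [glueBundleMk_inl_mem he, incl₁_of_mem (y := ⟨e.1, he⟩) rfl]
  · rw [glueBundleMk_inl_not_mem he, incl₁_of_not_mem _ _ he]

theorem glueBundleMk_inl_add {x : X₁} {s t : E₁ x} {z : Glue f} {v w : GlueFibre f F z}
    (hv : glueBundleMk f F (.inl ⟨x, s⟩) = ⟨z, v⟩) (hw : glueBundleMk f F (.inl ⟨x, t⟩) = ⟨z, w⟩) :
    glueBundleMk f F (.inl ⟨x, s + t⟩) = ⟨z, v + w⟩ := by
  by_cases hx : x ∈ Y
  · rw [glueBundleMk_inl_mem hx] at hv hw ⊢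
    cases hv
    cases hw
    rw [map_add]
    rfl
  · rw [glueBundleMk_inl_not_mem hx] at hv hw ⊢
    cases hv
    cases hw
    rfl

theorem glueBundleMk_inr_add {x : X₂} {s t : E₂ x} {z : Glue f} {v w : GlueFibre f F z}
    (hv : glueBundleMk f F (.inr ⟨x, s⟩) = ⟨z, v⟩) (hw : glueBundleMk f F (.inr ⟨x, t⟩) = ⟨z, w⟩) :
    glueBundleMk f F (.inr ⟨x, s + t⟩) = ⟨z, v + w⟩ := by
  cases hv
  cases hw
  rfl

theorem glueBundleMk_inl_smul {x : X₁} {s : E₁ x} {z : Glue f} {v : GlueFibre f F z}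
    (hv : glueBundleMk f F (.inl ⟨x, s⟩) = ⟨z, v⟩) (r : ℝ) :
    glueBundleMk f F (.inl ⟨x, r • s⟩) = ⟨z, r • v⟩ := by
  by_cases hx : x ∈ Y
  · rw [glueBundleMk_inl_mem hx] at hv ⊢
    cases hv
    rw [map_smul]
    rfl
  · rw [glueBundleMk_inl_not_mem hx] at hv ⊢
    cases hv
    rfl

theorem glueBundleMk_inr_smul {x : X₂} {s : E₂ x} {z : Glue f} {v : GlueFibre f F z}
    (hv : glueBundleMk f F (.inr ⟨x, s⟩) = ⟨z, v⟩) (r : ℝ) :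
    glueBundleMk f F (.inr ⟨x, r • s⟩) = ⟨z, r • v⟩ := by
  cases hv
  rfl

theorem glueBundleMk_inl_zero (x : X₁) :
    glueBundleMk f F (.inl ⟨x, 0⟩) = ⟨incl₁ f x, 0⟩ := by
  by_cases hx : x ∈ Y
  · rw [glueBundleMk_inl_mem hx, map_zero, incl₁_of_mem (y := ⟨x, hx⟩) rfl]
    rfl
  · rw [glueBundleMk_inl_not_mem hx, incl₁_of_not_mem _ _ hx]
    rfl

theorem inducedMetric_glueBundleMk_inl {g₁ : ∀ x, LinearMap.BilinForm ℝ (E₁ x)}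
    {g₂ : ∀ x, LinearMap.BilinForm ℝ (E₂ x)} (hg : CompatibleMetrics f F g₁ g₂)
    {x : X₁} {s t : E₁ x} {z : Glue f} {v w : GlueFibre f F z}
    (hv : glueBundleMk f F (.inl ⟨x, s⟩) = ⟨z, v⟩) (hw : glueBundleMk f F (.inl ⟨x, t⟩) = ⟨z, w⟩) :
    inducedMetric f F g₁ g₂ z v w = g₁ x s t := by
  by_cases hx : x ∈ Y
  · rw [glueBundleMk_inl_mem hx] at hv hw
    cases hv
    cases hw
    exact (hg ⟨x, hx⟩ s t).symm
  · rw [glueBundleMk_inl_not_mem hx] at hv hw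
    cases hv
    cases hw
    rfl

theorem inducedMetric_glueBundleMk_inr {g₁ : ∀ x, LinearMap.BilinForm ℝ (E₁ x)}
    {g₂ : ∀ x, LinearMap.BilinForm ℝ (E₂ x)}
    {x : X₂} {s t : E₂ x} {z : Glue f} {v w : GlueFibre f F z}
    (hv : glueBundleMk f F (.inr ⟨x, s⟩) = ⟨z, v⟩) (hw : glueBundleMk f F (.inr ⟨x, t⟩) = ⟨z, w⟩) :
    inducedMetric f F g₁ g₂ z v w = g₂ x s t := by
  cases hv
  cases hw
  rfl

variable [D₁ : DiffeologicalSpace (Σ x, E₁ x)] [D₂ : DiffeologicalSpace (Σ x, E₂ x)]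

theorem dSmooth_glueBundleMk_inl : DSmooth fun e : Σ x, E₁ x => glueBundleMk f F (.inl e) :=
  (dSmooth_coinduced (glueBundleMk f F)).comp dSmooth_inl

theorem dSmooth_glueBundleMk_inr : DSmooth fun e : Σ x, E₂ x => glueBundleMk f F (.inr e) :=
  (dSmooth_coinduced (glueBundleMk f F)).comp dSmooth_inr

variable [DiffeologicalSpace X₁] [DiffeologicalSpace X₂]

/-- Near a point, a plot of the glued bundle which lies over `i₂(X₂)` lifts to a plot of `E₂`: if it
lifts to a plot of `E₁`, the latter lies over `Y`, and `F` sends it to a plot of `E₂`. -/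
theorem exists_lift_inr_of_isPlot (hF : IsDiffeoOntoImage (totalMap f F)) {n : ℕ}
    {p : Euc n → Σ z : Glue f, GlueFibre f F z} (hp : IsPlot p) {u₀ : Euc n}
    (h : ∀ᶠ u in 𝓝 u₀, ∃ x, (p u).1 = .right x) :
    ∃ q : Euc n → Σ x, E₂ x, IsPlot q ∧ ∀ᶠ u in 𝓝 u₀, glueBundleMk f F (.inr (q u)) = p u := by
  rcases exists_lift_of_isPlot_coinduced_sum (glueBundleMk_surjective f F) hp u₀ with
    ⟨q, hq, hpq⟩ | ⟨q, hq, hpq⟩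
  · have hY : ∀ᶠ u in 𝓝 u₀, (q u).1 ∈ Y := by
      filter_upwards [h, hpq] with u ⟨x, hx⟩ hu
      rw [hu, glueBundleMk_inl_fst] at hx
      exact mem_of_incl₁_eq_right hx
    obtain ⟨r, hr, hrU, hr0⟩ := exists_contDiff_eventuallyEq_id hY
    refine ⟨fun u => totalMap f F ⟨q (r u), hrU u⟩,
      (hF.isPlot_iff n fun u => ⟨q (r u), hrU u⟩).1 (isPlot_reparam hq hr), ?_⟩
    filter_upwards [hr0, hpq] with u hu hpu
    have hu' : q (r u) = q u := congrArg q hu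
    rw [hpu, ← hu']
    exact (glueBundleMk_inl_mem (x := (q (r u)).1) (hrU u) (q (r u)).2).symm
  · exact ⟨q, hq, hpq.mono fun _ => Eq.symm⟩

/-- Two plots of the glued bundle over the same map lift locally to two plots of `E₁` over the same
map, or to two plots of `E₂` over the same map. -/
theorem exists_common_lift (hf : Function.Injective f) (hF : IsDiffeoOntoImage (totalMap f F))
    {n : ℕ} {p : Euc n → Glue f} {v w : ∀ u, GlueFibre f F (p u)}
    (hv : IsPlot fun u => (⟨p u, v u⟩ : Σ z, GlueFibre f F z))
    (hw : IsPlot fun u => (⟨p u, w u⟩ : Σ z, GlueFibre f F z)) (u₀ : Euc n) :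
    (∃ (a : Euc n → X₁) (s t : ∀ u, E₁ (a u)), IsPlot (fun u => (⟨a u, s u⟩ : Σ x, E₁ x)) ∧
      IsPlot (fun u => (⟨a u, t u⟩ : Σ x, E₁ x)) ∧ ∀ᶠ u in 𝓝 u₀,
        glueBundleMk f F (.inl ⟨a u, s u⟩) = ⟨p u, v u⟩ ∧
        glueBundleMk f F (.inl ⟨a u, t u⟩) = ⟨p u, w u⟩) ∨
    ∃ (a : Euc n → X₂) (s t : ∀ u, E₂ (a u)), IsPlot (fun u => (⟨a u, s u⟩ : Σ x, E₂ x)) ∧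
      IsPlot (fun u => (⟨a u, t u⟩ : Σ x, E₂ x)) ∧ ∀ᶠ u in 𝓝 u₀,
        glueBundleMk f F (.inr ⟨a u, s u⟩) = ⟨p u, v u⟩ ∧
        glueBundleMk f F (.inr ⟨a u, t u⟩) = ⟨p u, w u⟩ := by
  have hright : (∀ᶠ u in 𝓝 u₀, ∃ x, p u = .right x) →
      ∃ (a : Euc n → X₂) (s t : ∀ u, E₂ (a u)), IsPlot (fun u => (⟨a u, s u⟩ : Σ x, E₂ x)) ∧
      IsPlot (fun u => (⟨a u, t u⟩ : Σ x, E₂ x)) ∧ ∀ᶠ u in 𝓝 u₀,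
        glueBundleMk f F (.inr ⟨a u, s u⟩) = ⟨p u, v u⟩ ∧
        glueBundleMk f F (.inr ⟨a u, t u⟩) = ⟨p u, w u⟩ := by
    intro h
    obtain ⟨q, hq, hqv⟩ := exists_lift_inr_of_isPlot hF hv h
    obtain ⟨q', hq', hqw⟩ := exists_lift_inr_of_isPlot hF hw h
    have hfst : ∀ᶠ u in 𝓝 u₀, (q u).1 = (q' u).1 := by
      filter_upwards [hqv, hqw] with u h₁ h₂
      exact Glue.right.inj ((congrArg Sigma.fst h₁).trans (congrArg Sigma.fst h₂).symm)
    obtain ⟨a, s, t, hs, ht, hst⟩ := exists_sections_of_fst_eventuallyEq hq hq' hfst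
    refine ⟨a, s, t, hs, ht, ?_⟩
    filter_upwards [hqv, hqw, hst] with u h₁ h₂ h₃
    rw [← h₃.1, ← h₃.2]
    exact ⟨h₁, h₂⟩
  rcases exists_lift_of_isPlot_coinduced_sum (glueBundleMk_surjective f F) hv u₀ with
    ⟨q, hq, hqv⟩ | ⟨q, -, hqv⟩
  · rcases exists_lift_of_isPlot_coinduced_sum (glueBundleMk_surjective f F) hw u₀ with
      ⟨q', hq', hqw⟩ | ⟨q', -, hqw⟩
    · left
      have hfst : ∀ᶠ u in 𝓝 u₀, (q u).1 = (q' u).1 := by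
        filter_upwards [hqv, hqw] with u h₁ h₂
        refine eq_of_incl₁_eq hf ?_
        rw [← glueBundleMk_inl_fst (F := F), ← glueBundleMk_inl_fst (F := F), ← h₁, ← h₂]
      obtain ⟨a, s, t, hs, ht, hst⟩ := exists_sections_of_fst_eventuallyEq hq hq' hfst
      refine ⟨a, s, t, hs, ht, ?_⟩
      filter_upwards [hqv, hqw, hst] with u h₁ h₂ h₃
      rw [← h₃.1, ← h₃.2]
      exact ⟨h₁.symm, h₂.symm⟩
    · exact .inr (hright (hqw.mono fun u hu => ⟨_, congrArg Sigma.fst hu⟩))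
  · exact .inr (hright (hqv.mono fun u hu => ⟨_, congrArg Sigma.fst hu⟩))

/-- Over `X₁ \ Y`, the fibres of the glued bundle carry the diffeologies of the fibres of `E₁`. -/
theorem isPlot_left_iff {x : X₁} (hx : x ∉ Y) {n : ℕ} (γ : Euc n → E₁ x) :
    IsPlot (fun u => (⟨.left x hx, γ u⟩ : Σ z, GlueFibre f F z)) ↔
      IsPlot (fun u => (⟨x, γ u⟩ : Σ x, E₁ x)) := by
  refine ⟨fun h => isPlot_of_eventuallyEq fun u₀ => ?_, fun h => ?_⟩
  · rcases exists_lift_of_isPlot_coinduced_sum (glueBundleMk_surjective f F) h u₀ with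
      ⟨q, hq, hpq⟩ | ⟨q, -, hpq⟩
    · refine ⟨q, hq, hpq.mono fun u hu => ?_⟩
      have key : ∀ e : Σ x, E₁ x, (⟨.left x hx, γ u⟩ : Σ z, GlueFibre f F z) =
          glueBundleMk f F (.inl e) → (⟨x, γ u⟩ : Σ x, E₁ x) = e := by
        rintro ⟨x', e⟩ h
        by_cases hx' : x' ∈ Y
        · rw [glueBundleMk_inl_mem hx'] at h
          cases h
        · rw [glueBundleMk_inl_not_mem hx'] at h
          obtain ⟨h₁, h₂⟩ := Sigma.mk.inj_iff.1 h
          cases h₁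
          exact congrArg _ (eq_of_heq h₂)
      exact key _ hu
    · exact absurd (congrArg Sigma.fst hpq.self_of_nhds) (by simp [glueBundleMk])
  · have := dSmooth_glueBundleMk_inl (f := f) (F := F) n _ h
    refine cast (congrArg IsPlot (funext fun u => ?_)) this
    exact glueBundleMk_inl_not_mem hx (γ u)

/-- Over `i₂(X₂)`, the fibres of the glued bundle carry the diffeologies of the fibres of `E₂`. -/
theorem isPlot_right_iff (hF : IsDiffeoOntoImage (totalMap f F)) {x : X₂} {n : ℕ}
    (γ : Euc n → E₂ x) :
    IsPlot (fun u => (⟨.right x, γ u⟩ : Σ z, GlueFibre f F z)) ↔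
      IsPlot (fun u => (⟨x, γ u⟩ : Σ x, E₂ x)) := by
  refine ⟨fun h => isPlot_of_eventuallyEq fun u₀ => ?_, fun h => ?_⟩
  · obtain ⟨q, hq, hpq⟩ := exists_lift_inr_of_isPlot hF h (u₀ := u₀) (.of_forall fun u => ⟨x, rfl⟩)
    refine ⟨q, hq, hpq.mono fun u hu => ?_⟩
    have key : ∀ e : Σ x, E₂ x, glueBundleMk f F (.inr e) =
        (⟨.right x, γ u⟩ : Σ z, GlueFibre f F z) → (⟨x, γ u⟩ : Σ x, E₂ x) = e := by
      rintro ⟨x', e⟩ h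
      obtain ⟨h₁, h₂⟩ := Sigma.mk.inj_iff.1 h
      cases h₁
      exact congrArg _ (eq_of_heq h₂).symm
    exact key _ hu
  · exact dSmooth_glueBundleMk_inr (f := f) (F := F) n _ h

theorem isPseudoBundle_glueFibre (hf : Function.Injective f)
    (hF : IsDiffeoOntoImage (totalMap f F)) (hE₁ : IsPseudoBundle E₁ D₁)
    (hE₂ : IsPseudoBundle E₂ D₂) : IsPseudoBundle (GlueFibre f F) inferInstance where
  proj n p hp := by
    refine isPlot_of_eventuallyEq fun u₀ => ?_
    rcases exists_lift_of_isPlot_coinduced_sum (glueBundleMk_surjective f F) hp u₀ with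
      ⟨q, hq, hpq⟩ | ⟨q, hq, hpq⟩
    · refine ⟨_, dSmooth_incl₁ f _ _ (hE₁.proj _ _ hq), hpq.mono fun u hu => ?_⟩
      simp only [Function.comp_apply, hu, glueBundleMk_inl_fst]
    · refine ⟨_, dSmooth_incl₂ f _ _ (hE₂.proj _ _ hq), hpq.mono fun u hu => ?_⟩
      simp only [Function.comp_apply, hu]
      rfl
  add n p v w hv hw := by
    refine isPlot_of_eventuallyEq fun u₀ => ?_
    rcases exists_common_lift hf hF hv hw u₀ with ⟨a, s, t, hs, ht, h⟩ | ⟨a, s, t, hs, ht, h⟩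
    · exact ⟨_, dSmooth_glueBundleMk_inl _ _ (hE₁.add n a s t hs ht),
        h.mono fun u hu => (glueBundleMk_inl_add hu.1 hu.2).symm⟩
    · exact ⟨_, dSmooth_glueBundleMk_inr _ _ (hE₂.add n a s t hs ht),
        h.mono fun u hu => (glueBundleMk_inr_add hu.1 hu.2).symm⟩
  smul n p r v hr hv := by
    refine isPlot_of_eventuallyEq fun u₀ => ?_
    rcases exists_common_lift hf hF hv hv u₀ with ⟨a, s, _, hs, -, h⟩ | ⟨a, s, _, hs, -, h⟩
    · exact ⟨_, dSmooth_glueBundleMk_inl _ _ (hE₁.smul n a r s hr hs),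
        h.mono fun u hu => (glueBundleMk_inl_smul hu.1 _).symm⟩
    · exact ⟨_, dSmooth_glueBundleMk_inr _ _ (hE₂.smul n a r s hr hs),
        h.mono fun u hu => (glueBundleMk_inr_smul hu.1 _).symm⟩
  zero n p hp := by
    refine isPlot_of_eventuallyEq fun u₀ => ?_
    rcases exists_lift_of_isPlot_glue hp u₀ with ⟨a, ha, h⟩ | ⟨a, ha, h⟩
    · refine ⟨_, dSmooth_glueBundleMk_inl (f := f) (F := F) _ _ (hE₁.zero n a ha),
        h.mono fun u hu => ?_⟩
      exact (congrArg (fun z => (⟨z, 0⟩ : Σ z, GlueFibre f F z)) hu.symm).trans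
        (glueBundleMk_inl_zero _).symm
    · refine ⟨_, dSmooth_glueBundleMk_inr (f := f) (F := F) _ _ (hE₂.zero n a ha),
        h.mono fun u hu => ?_⟩
      exact congrArg (fun z => (⟨z, 0⟩ : Σ z, GlueFibre f F z)) hu.symm

theorem isPseudoMetric_inducedMetric (hf : Function.Injective f)
    (hF : IsDiffeoOntoImage (totalMap f F)) {g₁ : ∀ x, LinearMap.BilinForm ℝ (E₁ x)}
    {g₂ : ∀ x, LinearMap.BilinForm ℝ (E₂ x)} (hg₁ : IsPseudoMetric g₁) (hg₂ : IsPseudoMetric g₂)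
    (hg : CompatibleMetrics f F g₁ g₂) : IsPseudoMetric (inducedMetric f F g₁ g₂) where
  finite
    | .left x _ => hg₁.finite x
    | .right x => hg₂.finite x
  symm
    | .left x _ => hg₁.symm x
    | .right x => hg₂.symm x
  nonneg
    | .left x _ => hg₁.nonneg x
    | .right x => hg₂.nonneg x
  smooth n p v w hv hw := by
    refine isPlot_of_eventuallyEq fun u₀ => ?_
    rcases exists_common_lift hf hF hv hw u₀ with ⟨a, s, t, hs, ht, h⟩ | ⟨a, s, t, hs, ht, h⟩
    · exact ⟨_, hg₁.smooth n a s t hs ht,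
        h.mono fun u hu => inducedMetric_glueBundleMk_inl hg hu.1 hu.2⟩
    · exact ⟨_, hg₂.smooth n a s t hs ht,
        h.mono fun u hu => inducedMetric_glueBundleMk_inr hu.1 hu.2⟩
  rank
    | .left x hx => by
      have h : fibreDiffeology (GlueFibre f F) (.left x hx) = fibreDiffeology E₁ x := by
        ext n γ
        exact isPlot_left_iff hx γ
      have h' : smoothDual (GlueFibre f F) (.left x hx) = smoothDual E₁ x := by
        ext φ
        change @DSmooth (E₁ x) ℝ (fibreDiffeology (GlueFibre f F) (.left x hx)) _ φ ↔
          @DSmooth (E₁ x) ℝ (fibreDiffeology E₁ x) _ φ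
        rw [h]
      rw [h']
      exact hg₁.rank x
    | .right x => by
      have h : fibreDiffeology (GlueFibre f F) (.right x) = fibreDiffeology E₂ x := by
        ext n γ
        exact isPlot_right_iff hF γ
      have h' : smoothDual (GlueFibre f F) (.right x) = smoothDual E₂ x := by
        ext φ
        change @DSmooth (E₂ x) ℝ (fibreDiffeology (GlueFibre f F) (.right x)) _ φ ↔
          @DSmooth (E₂ x) ℝ (fibreDiffeology E₂ x) _ φ
        rw [h]
      rw [h']
      exact hg₂.rank x

end GlueBundle

/-! ### The induced Clifford action -/

section GlueAction

variable {X₁ : Type u₁} {X₂ : Type u₂} [DiffeologicalSpace X₁] [DiffeologicalSpace X₂]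
  {Y : Set X₁} {f : Y → X₂} {E₁ : X₁ → Type v} {E₂ : X₂ → Type v}
  [∀ x, AddCommGroup (E₁ x)] [∀ x, Module ℝ (E₁ x)]
  [∀ x, AddCommGroup (E₂ x)] [∀ x, Module ℝ (E₂ x)]
  {F : ∀ y : Y, E₁ (y : X₁) →ₗ[ℝ] E₂ (f y)}
  {gΛ₁ : ∀ x, LinearMap.BilinForm ℝ (Lam X₁ x)} {gΛ₂ : ∀ x, LinearMap.BilinForm ℝ (Lam X₂ x)}
  {c₁ : ∀ x, Cliff gΛ₁ x →ₐ[ℝ] Module.End ℝ (E₁ x)}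
  {c₂ : ∀ x, Cliff gΛ₂ x →ₐ[ℝ] Module.End ℝ (E₂ x)}

/-- By compatibility, `α` acts as `c₁(ρ̃₁(α))` over the whole image of `X₁`. -/
theorem glueBundleMk_inl_action (hc : CompatibleActions f F c₁ c₂) {x : X₁} {s : E₁ x} {z : Glue f}
    (hz : incl₁ f x = z) {e : GlueFibre f F z} (he : glueBundleMk f F (.inl ⟨x, s⟩) = ⟨z, e⟩)
    (α : Lam (Glue f) z) :
    glueBundleMk f F (.inl ⟨x, c₁ x (CliffordAlgebra.ι _ (rho₁ f x z hz α)) s⟩) =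
      ⟨z, inducedLinearAction f F c₁ c₂ z α e⟩ := by
  by_cases hx : x ∈ Y
  · rw [glueBundleMk_inl_mem hx] at he ⊢
    cases he
    exact congrArg (Sigma.mk _) (hc ⟨x, hx⟩ α s).symm
  · rw [glueBundleMk_inl_not_mem hx] at he ⊢
    cases he
    rfl

theorem glueBundleMk_inr_action {x : X₂} {s : E₂ x} {z : Glue f}
    (hz : incl₂ f x = z) {e : GlueFibre f F z} (he : glueBundleMk f F (.inr ⟨x, s⟩) = ⟨z, e⟩)
    (α : Lam (Glue f) z) :
    glueBundleMk f F (.inr ⟨x, c₂ x (CliffordAlgebra.ι _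
      (pullbackAt (incl₂ f) (dSmooth_incl₂ f) x z hz α)) s⟩) =
      ⟨z, inducedLinearAction f F c₁ c₂ z α e⟩ := by
  cases he
  rfl

theorem inducedAction_ι (hf : DSmooth f) (hg : CompatibleLamMetrics f hf gΛ₁ gΛ₂) (z : Glue f)
    (α : Lam (Glue f) z) :
    inducedAction f hf F hg c₁ c₂ z (CliffordAlgebra.ι _ α) =
      inducedLinearAction f F c₁ c₂ z α :=
  CliffordAlgebra.lift_ι_apply _ _ _

theorem isUnitaryAction_inducedAction (hf : DSmooth f) (hg : CompatibleLamMetrics f hf gΛ₁ gΛ₂)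
    {g₁ : ∀ x, LinearMap.BilinForm ℝ (E₁ x)} {g₂ : ∀ x, LinearMap.BilinForm ℝ (E₂ x)}
    (h₁ : IsUnitaryAction gΛ₁ g₁ c₁) (h₂ : IsUnitaryAction gΛ₂ g₂ c₂) :
    IsUnitaryAction (inducedLamMetric f gΛ₁ gΛ₂) (inducedMetric f F g₁ g₂)
      (inducedAction f hf F hg c₁ c₂) := by
  rintro (⟨x, hx⟩ | x) α hα e₁ e₂
  · simp only [inducedAction_ι]
    exact h₁ x (rho₁ f x _ (incl₁_of_not_mem f x hx) α) hα e₁ e₂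
  · simp only [inducedAction_ι]
    rw [inducedLamMetric_right f hf gΛ₁ gΛ₂ hg] at hα
    exact h₂ x (rho₂ f x α) hα e₁ e₂

variable [D₁ : DiffeologicalSpace (Σ x, E₁ x)] [D₂ : DiffeologicalSpace (Σ x, E₂ x)]

theorem isPlot_inducedLinearAction (hE₁ : IsPseudoBundle E₁ D₁) (hE₂ : IsPseudoBundle E₂ D₂)
    (hc₁ : IsSmoothAction gΛ₁ c₁) (hc₂ : IsSmoothAction gΛ₂ c₂) (hc : CompatibleActions f F c₁ c₂)
    {n : ℕ} {p : Euc n → Glue f} {α : ∀ u, Lam (Glue f) (p u)} {e : ∀ u, GlueFibre f F (p u)}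
    (hα : IsPlot fun u => (⟨p u, α u⟩ : Σ z, Lam (Glue f) z))
    (he : IsPlot fun u => (⟨p u, e u⟩ : Σ z, GlueFibre f F z)) :
    IsPlot fun u => (⟨p u, inducedLinearAction f F c₁ c₂ (p u) (α u) (e u)⟩ :
      Σ z, GlueFibre f F z) := by
  refine isPlot_of_eventuallyEq fun u₀ => ?_
  rcases exists_lift_of_isPlot_coinduced_sum (glueBundleMk_surjective f F) he u₀ with
    ⟨q, hq, h⟩ | ⟨q, hq, h⟩
  · obtain ⟨β, hβ, h'⟩ :=
      exists_isPlot_pullbackAt (dSmooth_incl₁ f) hα (hE₁.proj n q hq) u₀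
    refine ⟨_, dSmooth_glueBundleMk_inl _ _ (hc₁.isPlot_ι hβ hq), ?_⟩
    filter_upwards [h, h'] with u hu hu'
    have hz : incl₁ f (q u).1 = p u := (glueBundleMk_inl_fst (q u)).symm.trans
      (congrArg Sigma.fst hu).symm
    refine (glueBundleMk_inl_action hc hz hu.symm (α u)).symm.trans ?_
    exact congrArg
      (fun β => glueBundleMk f F (.inl ⟨(q u).1, c₁ _ (CliffordAlgebra.ι _ β) (q u).2⟩)) (hu' hz)
  · obtain ⟨β, hβ, h'⟩ :=
      exists_isPlot_pullbackAt (dSmooth_incl₂ f) hα (hE₂.proj n q hq) u₀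
    refine ⟨_, dSmooth_glueBundleMk_inr _ _ (hc₂.isPlot_ι hβ hq), ?_⟩
    filter_upwards [h, h'] with u hu hu'
    have hz : incl₂ f (q u).1 = p u := (congrArg Sigma.fst hu).symm
    refine (glueBundleMk_inr_action (c₁ := c₁) hz hu.symm (α u)).symm.trans ?_
    exact congrArg
      (fun β => glueBundleMk f F (.inr ⟨(q u).1, c₂ _ (CliffordAlgebra.ι _ β) (q u).2⟩)) (hu' hz)

end GlueAction

end DiffGluing

end

theorem mainTheorem4 {X₁ : Type u₁} {X₂ : Type u₂}
    [DiffeologicalSpace X₁] [DiffeologicalSpace X₂]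
    -- the gluing diffeomorphism of the bases
    (Y : Set X₁) (f : Y → X₂) (hf : DiffGluing.IsDiffeoOntoImage f)
    (hΩ : DiffGluing.SamePushforward f hf.dSmooth)
    -- compatible pseudo-metrics on the pseudo-bundles of values of 1-forms
    (gΛ₁ : ∀ x, LinearMap.BilinForm ℝ (DiffGluing.Lam X₁ x))
    (gΛ₂ : ∀ x, LinearMap.BilinForm ℝ (DiffGluing.Lam X₂ x))
    (hgΛ₁ : DiffGluing.IsPseudoMetric gΛ₁) (hgΛ₂ : DiffGluing.IsPseudoMetric gΛ₂)
    (hgΛ : DiffGluing.CompatibleLamMetrics f hf.dSmooth gΛ₁ gΛ₂)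
    -- the pseudo-bundles of Clifford modules
    {E₁ : X₁ → Type v} [∀ x, AddCommGroup (E₁ x)] [∀ x, Module ℝ (E₁ x)]
    [D₁ : DiffeologicalSpace (Σ x, E₁ x)] (hE₁ : DiffGluing.IsPseudoBundle E₁ D₁)
    {E₂ : X₂ → Type v} [∀ x, AddCommGroup (E₂ x)] [∀ x, Module ℝ (E₂ x)]
    [D₂ : DiffeologicalSpace (Σ x, E₂ x)] (hE₂ : DiffGluing.IsPseudoBundle E₂ D₂)
    -- the gluing diffeomorphism of the pseudo-bundles, a fibrewise linear lift of `f`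
    (F : ∀ y : Y, E₁ (y : X₁) →ₗ[ℝ] E₂ (f y))
    (hF : DiffGluing.IsDiffeoOntoImage (DiffGluing.totalMap f F))
    -- compatible smooth Clifford actions
    (c₁ : ∀ x, DiffGluing.Cliff gΛ₁ x →ₐ[ℝ] Module.End ℝ (E₁ x))
    (hc₁ : DiffGluing.IsSmoothAction gΛ₁ c₁)
    (c₂ : ∀ x, DiffGluing.Cliff gΛ₂ x →ₐ[ℝ] Module.End ℝ (E₂ x))
    (hc₂ : DiffGluing.IsSmoothAction gΛ₂ c₂)
    (hc : DiffGluing.CompatibleActions f F c₁ c₂)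
    -- compatible pseudo-metrics on the Clifford modules
    (g₁ : ∀ x, LinearMap.BilinForm ℝ (E₁ x)) (g₂ : ∀ x, LinearMap.BilinForm ℝ (E₂ x))
    (hg₁ : DiffGluing.IsPseudoMetric g₁) (hg₂ : DiffGluing.IsPseudoMetric g₂)
    (hg : DiffGluing.CompatibleMetrics f F g₁ g₂) :
    -- the induced objects have the required type
    DiffGluing.IsPseudoBundle (DiffGluing.GlueFibre f F) inferInstance ∧
    DiffGluing.IsPseudoMetric (DiffGluing.inducedLamMetric f gΛ₁ gΛ₂) ∧
    DiffGluing.IsPseudoMetric (DiffGluing.inducedMetric f F g₁ g₂) ∧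
    DiffGluing.IsSmoothAction (DiffGluing.inducedLamMetric f gΛ₁ gΛ₂)
      (DiffGluing.inducedAction f hf.dSmooth F hgΛ c₁ c₂) ∧
    -- and the induced action is unitary if `c₁` and `c₂` are
    (DiffGluing.IsUnitaryAction gΛ₁ g₁ c₁ → DiffGluing.IsUnitaryAction gΛ₂ g₂ c₂ →
      DiffGluing.IsUnitaryAction (DiffGluing.inducedLamMetric f gΛ₁ gΛ₂)
        (DiffGluing.inducedMetric f F g₁ g₂)
        (DiffGluing.inducedAction f hf.dSmooth F hgΛ c₁ c₂)) := by
  have hinj := hf.injective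
  have hE := DiffGluing.isPseudoBundle_glueFibre hinj hF hE₁ hE₂
  refine ⟨hE, DiffGluing.isPseudoMetric_inducedLamMetric hf.dSmooth hgΛ hgΛ₁ hgΛ₂,
    DiffGluing.isPseudoMetric_inducedMetric hinj hF hg₁ hg₂ hg,
    DiffGluing.isSmoothAction_of_ι hE DiffGluing.dSmooth_lam_fst fun n p α e hα he => ?_,
    fun h₁ h₂ => DiffGluing.isUnitaryAction_inducedAction hf.dSmooth hgΛ h₁ h₂⟩
  simp only [DiffGluing.inducedAction_ι]
  exact DiffGluing.isPlot_inducedLinearAction hE₁ hE₂ hc₁ hc₂ hc hα he
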